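/- Let $K\ge 2$ and let $(z_1,\dots,z_K)$ be random variables with finite alphabets and an arbitrary joint distribution $P$. For a block length $L\ge 1$, let $Z_k=(Z_k(1),\dots,Z_k(L))$, where the tuples $(Z_1(l),\dots,Z_K(l))$, $1\le l\le L$, are i.i.d. with law $P$. A transmitter knows $Z_1,\dots,Z_K$, and Receiver $k$ knows $Z_k$. A groupcast scheme over $L$ key blocks consists of a finite field $\mathbb F_p$ ($p$ a prime power), a message $W$ uniform on $\mathbb F_p^{L_W}$ and independent of $(Z_1,\dots,Z_K)$, and a transmit signal $X\in\mathbb F_p^{L_X}$ produced from $(W,Z_1,\dots,Z_K)$ and seen by all receivers, together with a decoder for each receiver; $p$, $L_W$, $L_X$ may depend on the scheme. Its rate is $L_W\log_2 p/L$ and its broadcast bandwidth is $L_X\log_2 p/L$. Let $1\le N\le K-1$. A sequence of schemes, one for each $L=1,2,\dots$, is admissible for secure groupcast to the first $N$ receivers if, as $L\to\infty$, $$H(W\mid X,Z_k)=o(L)\ \text{ for } 1\le k\le N,\qquad I(W;X,Z_k)=o(L)\ \text{ for } N+1\le k\le K,$$ and the probability that Receiver $k$ decodes $W$ incorrectly tends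 to $0$ for each $1\le k\le N$. The capacity $C$ is the supremum of the $R$ for which there is an admissible sequence all of whose schemes have rate at least $R$. The minimum broadcast bandwidth $\beta^*(R)$ is the infimum of the $\beta$ for which there is an admissible sequence all of whose schemes have rate at least $R$ and broadcast bandwidth at most $\beta$. Then, with entropies in bits: 1. (Secure unicast, $N=1$.) $\displaystyle C=\beta^*(C)=\min_{2\le e\le K}H(z_1\mid z_e)$. 2. (Secure multicast, $N=K-1$.) $\displaystyle C=\min_{1\le q\le K-1}H(z_q\mid z_K)$. Both statements hold whether or not the transmitter is allowed private randomness in producing $X$, and whether or not vanishing decoding error probability is required in addition to $H(W\mid X,Z_k)=o(L)$. -/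

import Mathlib

open Filter Asymptotics

namespace SecureGroupcast

noncomputable section

section Entropy

variable {Ω α β : Type*}

/-- Shannon entropy `H(X)`, in bits, of a random variable `X` with values in a finite set. -/
def entropy (μ : PMF Ω) [Fintype α] (X : Ω → α) : ℝ :=
  (∑ a, Real.negMulLog ((μ.map X) a).toReal) / Real.log 2

/-- Conditional entropy `H(X | Y) = H(X, Y) - H(Y)`. -/
def condEntropy (μ : PMF Ω) [Fintype α] [Fintype β] (X : Ω → α) (Y : Ω → β) : ℝ :=
  entropy μ (fun ω => (X ω, Y ω)) - entropy μ Y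

/-- Mutual information `I(X; Y) = H(X) + H(Y) - H(X, Y)`. -/
def mutualInfo (μ : PMF Ω) [Fintype α] [Fintype β] (X : Ω → α) (Y : Ω → β) : ℝ :=
  entropy μ X + entropy μ Y - entropy μ (fun ω => (X ω, Y ω))

/-- The law of `L` independent samples from `P`. -/
def iid [Fintype α] (P : PMF α) (L : ℕ) : PMF (Fin L → α) :=
  PMF.ofFintype (fun z => ∏ l, P (z l)) (by
    classical
    have h : ∑ a, P a = 1 := by rw [← tsum_fintype (L := .unconditional _)]; exact P.tsum_coe
    have := Finset.prod_univ_sum (fun _ : Fin L => (Finset.univ : Finset α)) (fun _ a => P a)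
    rw [Fintype.piFinset_univ] at this
    rw [← this]
    simp [h])

end Entropy

variable {K : ℕ} {𝒵 : Fin K → Type*}

/-- The legitimate receivers: the first `N` of the `K` receivers. -/
def legitimate (K N : ℕ) : Finset (Fin K) := {k | k.val < N}

/-- The eavesdropping receivers: the last `K - N` of the `K` receivers. -/
def eavesdroppers (K N : ℕ) : Finset (Fin K) := {k | N ≤ k.val}

theorem legitimate_nonempty {K N : ℕ} (hN : 1 ≤ N) (hK : N < K) :
    (legitimate K N).Nonempty :=
  ⟨⟨0, by omega⟩, by simp [legitimate]; omega⟩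

theorem eavesdroppers_nonempty {K N : ℕ} (hK : N < K) : (eavesdroppers K N).Nonempty :=
  ⟨⟨N, hK⟩, by simp [eavesdroppers]⟩

/-- A groupcast scheme over key blocks of length `L`. Receiver `k` holds the `L` samples
`fun l => z l k` of its key; the transmitter sees `z` as a whole. The encoder may use private
randomness: `enc w z` is the conditional law of the transmit signal. -/
structure Scheme (𝒵 : Fin K → Type*) (L : ℕ) where
  /-- the finite field over which message and transmit signal are written -/
  F : Type
  [field : Field F]
  [fintype : Fintype F]
  /-- number of message symbols -/
  LW : ℕ
  /-- number of transmitted symbols -/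
  LX : ℕ
  enc : (Fin LW → F) → (Fin L → ∀ k, 𝒵 k) → PMF (Fin LX → F)
  dec : ∀ k, (Fin LX → F) → (Fin L → 𝒵 k) → (Fin LW → F)

attribute [instance] Scheme.field Scheme.fintype

namespace Scheme

variable {L : ℕ} (S : Scheme 𝒵 L)

/-- The message alphabet. -/
abbrev Msg : Type := Fin S.LW → S.F

/-- The alphabet of the transmit signal. -/
abbrev Sig : Type := Fin S.LX → S.F

/-- Outcomes `(W, Z, X)`: message, keys, transmit signal. -/
abbrev Outcome : Type _ := S.Msg × (Fin L → ∀ k, 𝒵 k) × S.Sig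

/-- The message `W`. -/
def W (ω : S.Outcome) : S.Msg := ω.1

/-- The key `Z_k` of Receiver `k`. -/
def Z (k : Fin K) (ω : S.Outcome) : Fin L → 𝒵 k := fun l => ω.2.1 l k

/-- The transmit signal `X`. -/
def X (ω : S.Outcome) : S.Sig := ω.2.2

/-- The joint law of `(W, Z, X)`: `W` is uniform and independent of `Z`, the key tuples are
i.i.d. with law `P`, and `X` is produced by the encoder. -/
def law [∀ k, Fintype (𝒵 k)] (P : PMF (∀ k, 𝒵 k)) : PMF S.Outcome :=
  (PMF.uniformOfFintype S.Msg).bind fun w =>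
    (iid P L).bind fun z => (S.enc w z).map fun x => (w, z, x)

/-- `H(W) / L`, i.e. `L_W log₂ p / L` bits per key block. -/
def rate : ℝ := S.LW * Real.logb 2 (Fintype.card S.F) / L

/-- `L_X log₂ p / L` bits per key block. -/
def bandwidth : ℝ := S.LX * Real.logb 2 (Fintype.card S.F) / L

/-- `H(W | X, Z_k)`. -/
def equivocation [∀ k, Fintype (𝒵 k)] (P : PMF (∀ k, 𝒵 k)) (k : Fin K) : ℝ :=
  condEntropy (S.law P) S.W (fun ω => (S.X ω, S.Z k ω))

/-- `I(W; X, Z_k)`. -/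
def leakage [∀ k, Fintype (𝒵 k)] (P : PMF (∀ k, 𝒵 k)) (k : Fin K) : ℝ :=
  mutualInfo (S.law P) S.W (fun ω => (S.X ω, S.Z k ω))

/-- The probability that Receiver `k` decodes a wrong message. -/
def errorProb [∀ k, Fintype (𝒵 k)] (P : PMF (∀ k, 𝒵 k)) (k : Fin K) : ℝ :=
  ((S.law P).toOuterMeasure {ω | S.dec k (S.X ω) (S.Z k ω) ≠ S.W ω}).toReal

/-- The transmit signal is a function of the message and the keys. -/
def IsDeterministic : Prop := ∀ w z, ∃ x, S.enc w z = PMF.pure x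

end Scheme

/-- Two conventions of the model on which the results do not depend. -/
structure Convention where
  /-- `true`: the transmit signal has to be a function of message and keys;
  `false`: the transmitter may randomize. -/
  deterministic : Bool
  /-- `true`: the decoding error probability of each legitimate receiver has to vanish, in
  addition to `H(W | X, Z_k) = o(L)`; `false`: only the latter is required. -/
  vanishingError : Bool

variable [∀ k, Fintype (𝒵 k)]

/-- The sequence of schemes `S L`, `L = 1, 2, …`, is correct at the first `N` receivers and
secure against each of the others. -/
def IsCorrectSecure (conv : Convention) (P : PMF (∀ k, 𝒵 k)) (N : ℕ)
    (S : ∀ L, Scheme 𝒵 L) : Prop :=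
  (conv.deterministic = true → ∀ L, (S L).IsDeterministic) ∧
  (conv.vanishingError = true →
    ∀ k ∈ legitimate K N, Tendsto (fun L => (S L).errorProb P k) atTop (nhds 0)) ∧
  (∀ k ∈ legitimate K N,
    (fun L => (S L).equivocation P k) =o[atTop] (fun L : ℕ => (L : ℝ))) ∧
  (∀ k ∈ eavesdroppers K N,
    (fun L => (S L).leakage P k) =o[atTop] (fun L : ℕ => (L : ℝ)))

/-- The rate `R` is achievable. -/
def AchievableRate (conv : Convention) (P : PMF (∀ k, 𝒵 k)) (N : ℕ) (R : ℝ) : Prop :=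
  ∃ S : ∀ L, Scheme 𝒵 L, IsCorrectSecure conv P N S ∧ ∀ L, 1 ≤ L → R ≤ (S L).rate

/-- The broadcast bandwidth `b` is achievable at rate `R`. -/
def AchievableBandwidth (conv : Convention) (P : PMF (∀ k, 𝒵 k)) (N : ℕ) (R b : ℝ) : Prop :=
  ∃ S : ∀ L, Scheme 𝒵 L, IsCorrectSecure conv P N S ∧
    ∀ L, 1 ≤ L → R ≤ (S L).rate ∧ (S L).bandwidth ≤ b

/-- `C` is the capacity: the supremum of the achievable rates. -/
def IsCapacity (conv : Convention) (P : PMF (∀ k, 𝒵 k)) (N : ℕ) (C : ℝ) : Prop :=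
  IsLUB {R | AchievableRate conv P N R} C

/-- `b` is the minimum broadcast bandwidth at rate `R`: the infimum of the broadcast bandwidths
achievable at that rate. -/
def IsMinBandwidth (conv : Convention) (P : PMF (∀ k, 𝒵 k)) (N : ℕ) (R b : ℝ) : Prop :=
  IsGLB {b' | AchievableBandwidth conv P N R b'} b

/-- `H(z_i | z_j)` for the single-letter keys. -/
def keyCondEntropy (P : PMF (∀ k, 𝒵 k)) (i j : Fin K) : ℝ :=
  condEntropy P (fun z => z i) (fun z => z j)

end

end SecureGroupcast

/-!
Two inequalities carry the converse. A message which Receiver `k` learns and Receiver `e` does not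
is covered by the uncertainty that remains about the key of `k` given the key of `e`, so its rate
is at most `H(z_k | z_e)` (`Scheme.message_bits_le`); and since the message is independent of the
key of `k`, everything `k` learns about it has to come from the transmit signal
(`Scheme.message_bits_le_signal_bits`).

Achievability rests on hashing. A random function of a block `U` into a set of `2 ^ m` elements
has, given side information `V`, conditional entropy at least `m - E log₂ (1 + 2 ^ m p(U | V))`
on average (`sum_hash_deficit_le`, a leftover hash lemma directly for Shannon entropy, which
avoids typical sets). For blocks of `L` independent samples the information density
`-log₂ p(U | V)` has mean `L H` and variance `O(L)`, so the gap is `O(√L)` as long as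
`m ≤ L H + O(1)`.

* Unicast: the signal is the message plus a hash of the key of the legitimate receiver, a one-time
  pad of exactly the length of the message. This meets the bandwidth bound.
* Multicast against Receiver `r`: put `H = H(z | z_r)` for the tuple `z` of all keys, and let `C` be
  the claimed capacity. The transmitter reveals the key block of `r` and a hash `g` of all keys, of
  a rate slightly above `max_q H(z | z_q, z_r) = H - C`. By Slepian–Wolf decoding each legitimate
  receiver recovers all keys. A second hash `f` of all keys, of a rate slightly below `C`, is the
  one-time pad; it is nearly uniform given `g` and the key of `r`, because `f` and `g` together
  have rate at most `H`.

The schemes obtained are deterministic, have error probability `O(1 / L)` and hence, by Fano's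
inequality, bounded equivocation, so they are admissible under every convention.
-/

namespace SecureGroupcast

/-! ### Expectations and point probabilities -/

section

variable {Ω α β γ δ : Type*}

/-- Expectation of a real function under a law on a finite set. -/
noncomputable def ev [Fintype Ω] (μ : PMF Ω) (φ : Ω → ℝ) : ℝ := ∑ ω, (μ ω).toReal * φ ω

open Classical in
/-- The probability of an event. -/
noncomputable def prob [Fintype Ω] (μ : PMF Ω) (p : Ω → Prop) : ℝ :=
  ev μ (fun ω => if p ω then 1 else 0)

/-- The probability that `X = a`. -/
noncomputable def pr (μ : PMF Ω) (X : Ω → α) (a : α) : ℝ := ((μ.map X) a).toReal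

theorem pr_nonneg {μ : PMF Ω} (X : Ω → α) (a : α) : 0 ≤ pr μ X a := ENNReal.toReal_nonneg

theorem pr_pos {μ : PMF Ω} (X : Ω → α) {ω : Ω} (h : μ ω ≠ 0) : 0 < pr μ X (X ω) := by
  refine ENNReal.toReal_pos ?_ (PMF.apply_ne_top _ _)
  rw [← PMF.mem_support_iff, PMF.support_map]
  exact ⟨ω, h, rfl⟩

/-- The conditional probability that `X = a` given `Y = b`; it is `0` if `Y = b` has
probability `0`. -/
noncomputable def condPr (μ : PMF Ω) (X : Ω → α) (Y : Ω → β) (a : α) (b : β) : ℝ :=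
  pr μ (fun ω => (X ω, Y ω)) (a, b) / pr μ Y b

theorem condPr_nonneg {μ : PMF Ω} (X : Ω → α) (Y : Ω → β) (a : α) (b : β) :
    0 ≤ condPr μ X Y a b :=
  div_nonneg (pr_nonneg _ _) (pr_nonneg _ _)

theorem condPr_pos {μ : PMF Ω} (X : Ω → α) (Y : Ω → β) {ω : Ω} (h : μ ω ≠ 0) :
    0 < condPr μ X Y (X ω) (Y ω) :=
  div_pos (pr_pos (fun ω => (X ω, Y ω)) h) (pr_pos Y h)

section Ev

theorem sum_toReal [Fintype Ω] (μ : PMF Ω) : ∑ ω, (μ ω).toReal = 1 := by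
  have h : ∑ ω, μ ω = 1 := by
    rw [← tsum_fintype (L := .unconditional _)]; exact μ.tsum_coe
  rw [← ENNReal.toReal_sum (fun a _ => μ.apply_ne_top a), h, ENNReal.toReal_one]

theorem sum_pr (μ : PMF Ω) [Fintype α] (X : Ω → α) : ∑ a, pr μ X a = 1 :=
  sum_toReal _

variable [Fintype Ω] (μ : PMF Ω)

theorem ev_const (c : ℝ) : ev μ (fun _ => c) = c := by
  simp [ev, ← Finset.sum_mul, sum_toReal]

theorem ev_add (φ ψ : Ω → ℝ) : ev μ (fun ω => φ ω + ψ ω) = ev μ φ + ev μ ψ := by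
  simp [ev, mul_add, Finset.sum_add_distrib]

theorem ev_sub (φ ψ : Ω → ℝ) : ev μ (fun ω => φ ω - ψ ω) = ev μ φ - ev μ ψ := by
  simp [ev, mul_sub, Finset.sum_sub_distrib]

theorem ev_const_mul (c : ℝ) (φ : Ω → ℝ) : ev μ (fun ω => c * φ ω) = c * ev μ φ := by
  simp only [ev, Finset.mul_sum]
  exact Finset.sum_congr rfl fun _ _ => by ring

theorem ev_sum {ι : Type*} (s : Finset ι) (φ : ι → Ω → ℝ) :
    ev μ (fun ω => ∑ i ∈ s, φ i ω) = ∑ i ∈ s, ev μ (φ i) := by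
  simp only [ev, Finset.mul_sum]
  exact Finset.sum_comm

variable {μ}

theorem ev_le_ev {φ ψ : Ω → ℝ} (h : ∀ ω, μ ω ≠ 0 → φ ω ≤ ψ ω) : ev μ φ ≤ ev μ ψ := by
  refine Finset.sum_le_sum fun ω _ => ?_
  by_cases h0 : μ ω = 0
  · simp [h0]
  · exact mul_le_mul_of_nonneg_left (h ω h0) ENNReal.toReal_nonneg

theorem ev_congr {φ ψ : Ω → ℝ} (h : ∀ ω, μ ω ≠ 0 → φ ω = ψ ω) : ev μ φ = ev μ ψ :=
  le_antisymm (ev_le_ev fun ω hω => (h ω hω).le) (ev_le_ev fun ω hω => (h ω hω).ge)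

theorem ev_nonneg {φ : Ω → ℝ} (h : ∀ ω, 0 ≤ φ ω) : 0 ≤ ev μ φ :=
  Finset.sum_nonneg fun ω _ => mul_nonneg ENNReal.toReal_nonneg (h ω)

theorem prob_eq_ev (p : Ω → Prop) [DecidablePred p] :
    prob μ p = ev μ (fun ω => if p ω then 1 else 0) :=
  ev_congr fun ω _ => by congr

theorem prob_nonneg (p : Ω → Prop) : 0 ≤ prob μ p :=
  ev_nonneg fun ω => by positivity

theorem pr_eq_ev [DecidableEq α] (X : Ω → α) (a : α) :
    pr μ X a = ev μ (fun ω => if X ω = a then 1 else 0) := by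
  rw [pr, PMF.map_apply, tsum_fintype, ENNReal.toReal_sum]
  · refine Finset.sum_congr rfl fun ω _ => ?_
    by_cases h : X ω = a
    · simp [h]
    · simp [h, Ne.symm h]
  · intro ω _
    split_ifs
    · exact μ.apply_ne_top ω
    · simp

theorem ev_map [Fintype α] (X : Ω → α) (φ : α → ℝ) : ev (μ.map X) φ = ev μ (fun ω => φ (X ω)) := by
  classical
  have h : ∀ a, ((μ.map X) a).toReal = ev μ (fun ω => if X ω = a then 1 else 0) := pr_eq_ev X
  simp only [ev] at h
  simp only [ev, h, Finset.sum_mul]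
  rw [Finset.sum_comm]
  refine Finset.sum_congr rfl fun ω _ => ?_
  simp

theorem sum_pr_mul [Fintype α] (X : Ω → α) (φ : α → ℝ) :
    ∑ a, pr μ X a * φ a = ev μ (fun ω => φ (X ω)) := ev_map X φ

theorem pr_pair_comp_eq_sum [Fintype α] [DecidableEq γ] (X : Ω → α) (Y : Ω → β) (f : α → γ)
    (c : γ) (b : β) :
    pr μ (fun ω => (f (X ω), Y ω)) (c, b) =
      ∑ a, if f a = c then pr μ (fun ω => (X ω, Y ω)) (a, b) else 0 := by
  classical
  have h : ∀ a, (if f a = c then pr μ (fun ω => (X ω, Y ω)) (a, b) else 0) =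
      ev μ (fun ω => (if f a = c then 1 else 0) * (if (X ω, Y ω) = (a, b) then 1 else 0)) := by
    intro a
    rw [ev_const_mul, ← pr_eq_ev]
    split_ifs <;> simp
  rw [Finset.sum_congr rfl fun a _ => h a, ← ev_sum, pr_eq_ev]
  refine ev_congr fun ω _ => ?_
  by_cases h1 : Y ω = b <;> simp [h1]

theorem prob_map [Fintype α] (X : Ω → α) (p : α → Prop) :
    prob (μ.map X) p = prob μ (fun ω => p (X ω)) :=
  ev_map X _

theorem prob_mono {p p' : Ω → Prop} (h : ∀ ω, p ω → p' ω) : prob μ p ≤ prob μ p' := by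
  classical
  rw [prob_eq_ev, prob_eq_ev]
  refine ev_le_ev fun ω _ => ?_
  have := h ω
  by_cases h1 : p ω
  · simp [h1, h ω h1]
  · rw [if_neg h1]
    positivity

theorem pr_le_pr_comp (X : Ω → α) (f : α → β) (a : α) :
    pr μ X a ≤ pr μ (fun ω => f (X ω)) (f a) := by
  classical
  rw [pr_eq_ev, pr_eq_ev]
  refine ev_le_ev fun ω _ => ?_
  split_ifs <;> simp_all

theorem sum_pr_pair [Fintype α] (X : Ω → α) (Y : Ω → β) (b : β) :
    ∑ a, pr μ (fun ω => (X ω, Y ω)) (a, b) = pr μ Y b := by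
  classical
  simp only [pr_eq_ev]
  rw [← ev_sum]
  refine ev_congr fun ω _ => ?_
  by_cases h : Y ω = b <;> simp [h]

theorem sum_condPr_le_one [Fintype α] (X : Ω → α) (Y : Ω → β) (b : β) :
    ∑ a, condPr μ X Y a b ≤ 1 := by
  simp only [condPr]
  rw [← Finset.sum_div, sum_pr_pair]
  exact div_self_le_one _

end Ev

/-! ### Entropy inequalities -/

theorem entropy_map {μ : PMF Ω} [Fintype α] (f : Ω → β) (X : β → α) :
    entropy (μ.map f) X = entropy μ (fun ω => X (f ω)) := by
  simp only [entropy, PMF.map_comp, Function.comp_def]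

section Entropy

variable [Fintype Ω] {μ : PMF Ω} [Fintype α] [Fintype β] [Fintype γ]

theorem entropy_eq_ev (X : Ω → α) : entropy μ X = ev μ (fun ω => -Real.logb 2 (pr μ X (X ω))) := by
  rw [← sum_pr_mul X (fun a => -Real.logb 2 (pr μ X a)), entropy, Finset.sum_div]
  refine Finset.sum_congr rfl fun a _ => ?_
  simp only [Real.negMulLog, Real.logb, pr]
  ring

theorem condEntropy_eq_ev (X : Ω → α) (Y : Ω → β) :
    condEntropy μ X Y = ev μ (fun ω => -Real.logb 2 (condPr μ X Y (X ω) (Y ω))) := by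
  rw [condEntropy, entropy_eq_ev, entropy_eq_ev, ← ev_sub]
  refine ev_congr fun ω hω => ?_
  rw [condPr, Real.logb_div (pr_pos (fun ω => (X ω, Y ω)) hω).ne' (pr_pos Y hω).ne']
  ring

/-- Data processing: a function of `X` has at most the entropy of `X`. -/
theorem entropy_comp_le (X : Ω → α) (f : α → β) : entropy μ (fun ω => f (X ω)) ≤ entropy μ X := by
  rw [entropy_eq_ev, entropy_eq_ev]
  refine ev_le_ev fun ω hω => neg_le_neg ?_
  exact Real.logb_le_logb_of_le one_lt_two (pr_pos X hω) (pr_le_pr_comp X f _)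

theorem condEntropy_nonneg (X : Ω → α) (Y : Ω → β) : 0 ≤ condEntropy μ X Y :=
  sub_nonneg.2 (entropy_comp_le (fun ω => (X ω, Y ω)) Prod.snd)

theorem logb_two_le {t s : ℝ} (ht : 0 < t) (hs : 0 < s) :
    Real.logb 2 t ≤ Real.logb 2 s + (t / s - 1) / Real.log 2 := by
  have h := Real.log_le_sub_one_of_pos (div_pos ht hs)
  rw [Real.log_div ht.ne' hs.ne'] at h
  have h2 := Real.log_pos one_lt_two
  rw [Real.logb, Real.logb, ← add_div]
  gcongr
  linarith

/-- Gibbs' inequality: the conditional entropy is at most the expected code length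
`-log₂ q(X | Y)` of any conditional (sub-)probability `q`. -/
theorem condEntropy_le_of_subprob (X : Ω → α) (Y : Ω → β) (q : α → β → ℝ)
    (hq : ∀ a b, 0 ≤ q a b) (hpos : ∀ ω, μ ω ≠ 0 → 0 < q (X ω) (Y ω))
    (hsum : ∀ b, ∑ a, q a b ≤ 1) :
    condEntropy μ X Y ≤ ev μ (fun ω => -Real.logb 2 (q (X ω) (Y ω))) := by
  have key : ev μ (fun ω => q (X ω) (Y ω) / condPr μ X Y (X ω) (Y ω)) ≤ 1 := by
    rw [← sum_pr_mul (fun ω => (X ω, Y ω)) (fun ab => q ab.1 ab.2 / condPr μ X Y ab.1 ab.2),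
      Fintype.sum_prod_type_right]
    calc ∑ b, ∑ a, pr μ (fun ω => (X ω, Y ω)) (a, b) * (q a b / condPr μ X Y a b)
        ≤ ∑ b, ∑ a, q a b * pr μ Y b := by
          refine Finset.sum_le_sum fun b _ => Finset.sum_le_sum fun a _ => ?_
          rcases (pr_nonneg (μ := μ) (fun ω => (X ω, Y ω)) (a, b)).eq_or_lt with h | h
          · rw [← h, zero_mul]
            exact mul_nonneg (hq a b) (pr_nonneg _ _)
          · apply le_of_eq
            rw [condPr]
            field_simp
      _ = ∑ b, (∑ a, q a b) * pr μ Y b := by simp only [Finset.sum_mul]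
      _ ≤ ∑ b, 1 * pr μ Y b :=
          Finset.sum_le_sum fun b _ => mul_le_mul_of_nonneg_right (hsum b) (pr_nonneg _ _)
      _ = 1 := by simp [sum_pr μ]
  have h2 := Real.log_pos one_lt_two
  have : condEntropy μ X Y - ev μ (fun ω => -Real.logb 2 (q (X ω) (Y ω))) ≤
      ev μ (fun ω => (1 / Real.log 2) * (q (X ω) (Y ω) / condPr μ X Y (X ω) (Y ω) - 1)) := by
    rw [condEntropy_eq_ev, ← ev_sub]
    refine ev_le_ev fun ω hω => ?_
    have := logb_two_le (hpos ω hω) (condPr_pos X Y hω)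
    rw [div_eq_inv_mul _ (Real.log 2), ← one_div] at this
    linarith
  rw [ev_const_mul, ev_sub, ev_const] at this
  have : (1 / Real.log 2) *
      (ev μ (fun ω => q (X ω) (Y ω) / condPr μ X Y (X ω) (Y ω)) - 1) ≤ 0 :=
    mul_nonpos_of_nonneg_of_nonpos (by positivity) (by linarith)
  linarith

/-- Conditioning on more reduces entropy. -/
theorem condEntropy_le_condEntropy_comp (X : Ω → α) (Y : Ω → β) (f : β → γ) :
    condEntropy μ X Y ≤ condEntropy μ X (fun ω => f (Y ω)) := by
  rw [condEntropy_eq_ev X (fun ω => f (Y ω))]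
  exact condEntropy_le_of_subprob X Y (fun a b => condPr μ X (fun ω => f (Y ω)) a (f b))
    (fun a b => condPr_nonneg _ _ _ _) (fun ω hω => condPr_pos X (fun ω => f (Y ω)) hω)
    fun b => sum_condPr_le_one _ _ _

theorem condEntropy_le_logb_card [Nonempty α] (X : Ω → α) (Y : Ω → β) :
    condEntropy μ X Y ≤ Real.logb 2 (Fintype.card α) := by
  have hc : (0 : ℝ) < Fintype.card α := by exact_mod_cast Fintype.card_pos
  refine (condEntropy_le_of_subprob X Y (fun _ _ => (Fintype.card α : ℝ)⁻¹)
    (fun _ _ => by positivity) (fun _ _ => by positivity) fun b => ?_).trans ?_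
  · simp [hc.ne']
  · rw [ev_const, Real.logb_inv, neg_neg]

/-- Fano's inequality. -/
theorem condEntropy_le_fano (X : Ω → α) (Y : Ω → β) (d : β → α) :
    condEntropy μ X Y ≤
      1 + prob μ (fun ω => d (Y ω) ≠ X ω) * Real.logb 2 (Fintype.card α) := by
  classical
  rw [prob_eq_ev]
  rcases isEmpty_or_nonempty α with hα | hα
  · exact (hα.false (X μ.support_nonempty.some)).elim
  have hc : (0 : ℝ) < Fintype.card α := by exact_mod_cast Fintype.card_pos
  -- half of the mass on the decoder's guess, half spread uniformly
  refine (condEntropy_le_of_subprob X Y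
    (fun a b => (1 / 2) * (if d b = a then 1 else 0) + (1 / 2) * (Fintype.card α : ℝ)⁻¹)
    (fun a b => by positivity) (fun ω _ => by positivity) fun b => ?_).trans ?_
  · rw [Finset.sum_add_distrib, ← Finset.mul_sum, ← Finset.mul_sum]
    simp [hc.ne']
    norm_num
  · rw [mul_comm (ev μ _), ← ev_const_mul]
    refine le_of_le_of_eq (ev_le_ev (ψ := fun ω =>
      1 + Real.logb 2 (Fintype.card α) * if d (Y ω) ≠ X ω then 1 else 0) ?_)
      (by rw [ev_add, ev_const])
    rintro ω -
    have hinv : (0 : ℝ) ≤ (Fintype.card α : ℝ)⁻¹ := by positivity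
    have hhalf : Real.logb 2 (1 / 2 : ℝ) = -1 := by
      rw [one_div, Real.logb_inv, Real.logb_self_eq_one one_lt_two]
    by_cases h : d (Y ω) = X ω
    · have : Real.logb 2 (1 / 2 : ℝ) ≤ Real.logb 2 (1 / 2 * 1 + 1 / 2 * (Fintype.card α : ℝ)⁻¹) :=
        Real.logb_le_logb_of_le one_lt_two (by norm_num) (by linarith)
      simp only [h, ne_eq, not_true_eq_false, if_true, if_false, mul_zero]
      linarith
    · simp only [h, ne_eq, not_false_eq_true, if_true, if_false, mul_zero, zero_add, mul_one]
      rw [Real.logb_mul (by norm_num) (by positivity), Real.logb_inv, hhalf]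
      linarith

end Entropy

/-! ### Independent pairs -/

/-- The law of a pair of independent outcomes. -/
noncomputable def indepPair (μ : PMF α) (ν : PMF β) : PMF (α × β) :=
  μ.bind fun a => ν.bind fun b => PMF.pure (a, b)

theorem indepPair_apply (μ : PMF α) (ν : PMF β) (x : α × β) : indepPair μ ν x = μ x.1 * ν x.2 := by
  classical
  obtain ⟨a, b⟩ := x
  have h : ∀ a', (∑' b', ν b' * PMF.pure (a', b') (a, b)) = if a' = a then ν b else 0 := by
    intro a'
    rw [tsum_eq_single b]
    · by_cases h : a' = a
      · simp [PMF.pure_apply, h]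
      · simp [PMF.pure_apply, h, Ne.symm h]
    · intro b' hb'
      simp [PMF.pure_apply, Ne.symm hb']
  simp only [indepPair, PMF.bind_apply, h]
  rw [tsum_eq_single a]
  · simp
  · intro a' ha'
    simp [ha']

theorem indepPair_map_fst (μ : PMF α) (ν : PMF β) : (indepPair μ ν).map Prod.fst = μ := by
  simp [indepPair, PMF.map_bind, PMF.pure_map, PMF.bind_const, PMF.bind_pure]

theorem indepPair_map_snd (μ : PMF α) (ν : PMF β) : (indepPair μ ν).map Prod.snd = ν := by
  simp [indepPair, PMF.map_bind, PMF.pure_map, PMF.bind_const, PMF.bind_pure]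

section IndepPair

variable [Fintype α] [Fintype β] [Fintype γ] [Fintype δ]

theorem ev_indepPair (μ : PMF α) (ν : PMF β) (φ : α → ℝ) (ψ : β → ℝ) :
    ev (indepPair μ ν) (fun x => φ x.1 * ψ x.2) = ev μ φ * ev ν ψ := by
  simp only [ev, Fintype.sum_prod_type, indepPair_apply, ENNReal.toReal_mul, Finset.sum_mul_sum]
  exact Finset.sum_congr rfl fun _ _ => Finset.sum_congr rfl fun _ _ => by ring

/-- Entropy is additive over independent components. -/
theorem entropy_indepPair (μ : PMF α) (ν : PMF β) (X : α → γ) (Y : β → δ) :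
    entropy (indepPair μ ν) (fun x => (X x.1, Y x.2)) = entropy μ X + entropy ν Y := by
  classical
  have h : ∀ c d, pr (indepPair μ ν) (fun x => (X x.1, Y x.2)) (c, d) = pr μ X c * pr ν Y d := by
    intro c d
    rw [pr_eq_ev, pr_eq_ev, pr_eq_ev, ← ev_indepPair]
    refine ev_congr fun x _ => ?_
    by_cases h1 : X x.1 = c <;> by_cases h2 : Y x.2 = d <;> simp [h1, h2]
  have hX : entropy μ X = entropy (indepPair μ ν) (fun x => X x.1) := by
    rw [← entropy_map Prod.fst X, indepPair_map_fst]
  have hY : entropy ν Y = entropy (indepPair μ ν) (fun x => Y x.2) := by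
    rw [← entropy_map Prod.snd Y, indepPair_map_snd]
  rw [entropy_eq_ev]
  simp only [h]
  rw [hX, hY, entropy_eq_ev, entropy_eq_ev, ← ev_add]
  refine ev_congr fun x hx => ?_
  have h1 : pr (indepPair μ ν) (fun x => X x.1) = pr μ X := by
    funext c
    simp only [pr]
    conv_rhs => rw [← indepPair_map_fst μ ν, PMF.map_comp]
    rfl
  have h2 : pr (indepPair μ ν) (fun x => Y x.2) = pr ν Y := by
    funext c
    simp only [pr]
    conv_rhs => rw [← indepPair_map_snd μ ν, PMF.map_comp]
    rfl
  have p1 := pr_pos (fun x : α × β => X x.1) hx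
  have p2 := pr_pos (fun x : α × β => Y x.2) hx
  rw [h1] at p1 ⊢
  rw [h2] at p2 ⊢
  rw [Real.logb_mul p1.ne' p2.ne']
  ring

theorem entropy_uniform [Nonempty α] :
    entropy (PMF.uniformOfFintype α) (fun a => a) = Real.logb 2 (Fintype.card α) := by
  have h : ∀ a, pr (PMF.uniformOfFintype α) (fun a => a) a = (Fintype.card α : ℝ)⁻¹ := by
    intro a
    have h : (PMF.uniformOfFintype α).map (fun a => a) = PMF.uniformOfFintype α := PMF.map_id _
    simp [pr, h]
  rw [entropy_eq_ev]
  simp only [h]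
  rw [ev_const, Real.logb_inv, neg_neg]

end IndepPair

end

/-! ### Blocks of independent samples -/

section

variable {α β γ : Type*} [Fintype α] {L : ℕ}

theorem iid_apply (P : PMF α) (z : Fin L → α) : iid P L z = ∏ l, P (z l) := rfl

theorem apply_ne_zero_of_iid {P : PMF α} {z : Fin L → α} (hz : iid P L z ≠ 0) (l : Fin L) :
    P (z l) ≠ 0 :=
  Finset.prod_ne_zero_iff.1 (iid_apply P z ▸ hz) l (Finset.mem_univ l)

theorem ev_iid_prod (P : PMF α) (ψ : Fin L → α → ℝ) :
    ev (iid P L) (fun z => ∏ l, ψ l (z l)) = ∏ l, ev P (ψ l) := by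
  classical
  simp only [ev, Finset.prod_univ_sum, Fintype.piFinset_univ]
  refine Finset.sum_congr rfl fun z _ => ?_
  rw [iid_apply, ENNReal.toReal_prod, Finset.prod_mul_distrib]

theorem ev_iid_coord (P : PMF α) (φ : α → ℝ) (l : Fin L) :
    ev (iid P L) (fun z => φ (z l)) = ev P φ := by
  have h := ev_iid_prod (L := L) P (fun j a => if j = l then φ a else 1)
  have h' : ∀ j, ev P (fun a => if j = l then φ a else 1) = if j = l then ev P φ else 1 := by
    intro j
    split_ifs
    · rfl
    · exact ev_const P 1
  simpa [h'] using h

/-- A sum of independent centred terms has the sum of the variances as its second moment. -/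
theorem ev_iid_sum_sq (P : PMF α) (φ : α → ℝ) (h0 : ev P φ = 0) :
    ev (iid P L) (fun z => (∑ l, φ (z l)) ^ 2) = L * ev P (fun a => φ a ^ 2) := by
  have hpair : ∀ l l' : Fin L, ev (iid P L) (fun z => φ (z l) * φ (z l')) =
      if l = l' then ev P (fun a => φ a ^ 2) else 0 := by
    intro l l'
    split_ifs with h
    · subst h
      simp only [sq]
      exact ev_iid_coord P (fun a => φ a * φ a) l
    · have h := ev_iid_prod (L := L) P
        (fun j a => (if j = l then φ a else 1) * (if j = l' then φ a else 1))
      simp only [Finset.prod_mul_distrib, Finset.prod_ite_eq', Finset.mem_univ, if_true] at h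
      rw [h]
      refine Finset.prod_eq_zero (Finset.mem_univ l) ?_
      simpa [‹¬ l = l'›] using h0
  simp only [sq, Finset.sum_mul_sum]
  rw [ev_sum]
  simp only [ev_sum, hpair]
  simp [sq]

theorem pr_iid (P : PMF α) (f : α → β) (b : Fin L → β) :
    pr (iid P L) (fun z l => f (z l)) b = ∏ l, pr P f (b l) := by
  classical
  simp only [pr_eq_ev]
  rw [← ev_iid_prod]
  refine ev_congr fun z _ => ?_
  rw [Finset.prod_ite_zero]
  simp [funext_iff]

theorem condPr_iid (P : PMF α) (f : α → β) (g : α → γ) (u : Fin L → β) (v : Fin L → γ) :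
    condPr (iid P L) (fun z l => f (z l)) (fun z l => g (z l)) u v =
      ∏ l, condPr P f g (u l) (v l) := by
  classical
  have h : pr (iid P L) (fun z => ((fun l => f (z l)), fun l => g (z l))) (u, v) =
      pr (iid P L) (fun z l => (f (z l), g (z l))) (fun l => (u l, v l)) := by
    rw [pr_eq_ev, pr_eq_ev]
    refine ev_congr fun z _ => ?_
    simp [funext_iff, forall_and]
  simp only [condPr]
  rw [h, pr_iid P (fun a => (f a, g a)), pr_iid P g, Finset.prod_div_distrib]

theorem neg_logb_condPr_iid (P : PMF α) (f : α → β) (g : α → γ) {z : Fin L → α}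
    (hz : iid P L z ≠ 0) :
    -Real.logb 2 (condPr (iid P L) (fun z l => f (z l)) (fun z l => g (z l))
        (fun l => f (z l)) (fun l => g (z l))) =
      ∑ l, -Real.logb 2 (condPr P f g (f (z l)) (g (z l))) := by
  rw [condPr_iid, Real.logb_prod, Finset.sum_neg_distrib]
  exact fun l _ => (condPr_pos f g (apply_ne_zero_of_iid hz l)).ne'

theorem condEntropy_iid [Fintype β] [Fintype γ] (P : PMF α) (f : α → β) (g : α → γ) :
    condEntropy (iid P L) (fun z l => f (z l)) (fun z l => g (z l)) = L * condEntropy P f g := by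
  rw [condEntropy_eq_ev, ev_congr fun z hz => neg_logb_condPr_iid P f g hz, ev_sum,
    Finset.sum_congr rfl fun l _ =>
      ev_iid_coord P (fun a => -Real.logb 2 (condPr P f g (f a) (g a))) l,
    condEntropy_eq_ev]
  simp

/-- The variance of the conditional information density `-log₂ p(f | g)`. -/
noncomputable def infoVar [Fintype β] [Fintype γ] (P : PMF α) (f : α → β) (g : α → γ) : ℝ :=
  ev P (fun a => (-Real.logb 2 (condPr P f g (f a) (g a)) - condEntropy P f g) ^ 2)

theorem infoVar_nonneg [Fintype β] [Fintype γ] (P : PMF α) (f : α → β) (g : α → γ) :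
    0 ≤ infoVar P f g :=
  ev_nonneg fun _ => sq_nonneg _

theorem ev_iid_info_sq [Fintype β] [Fintype γ] (P : PMF α) (f : α → β) (g : α → γ) :
    ev (iid P L) (fun z => (-Real.logb 2 (condPr (iid P L) (fun z l => f (z l))
        (fun z l => g (z l)) (fun l => f (z l)) (fun l => g (z l))) -
        L * condEntropy P f g) ^ 2) = L * infoVar P f g := by
  rw [infoVar, ← ev_iid_sum_sq]
  · refine ev_congr fun z hz => ?_
    rw [neg_logb_condPr_iid P f g hz, Finset.sum_sub_distrib]
    simp
  · rw [ev_sub, ev_const, ← condEntropy_eq_ev, sub_self]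

end

/-! ### Universal hashing -/

section

variable {Ω α β B B' I J : Type*}

open Classical in
/-- A family of hash functions `h i : α → B`, with `i` drawn uniformly, is universal if two
distinct points collide with probability at most `1 / |B|`. -/
def IsUniversal [Fintype I] [Fintype B] (h : I → α → B) : Prop :=
  ∀ u u', u ≠ u' →
    (Fintype.card B : ℝ) * ∑ i, (if h i u = h i u' then (1 : ℝ) else 0) ≤ Fintype.card I

theorem isUniversal_id [Fintype α] [DecidableEq α] [Fintype B] :
    IsUniversal (fun h : α → B => h) := by
  classical
  intro u u' huu
  have h1 : ∑ h : α → B, (if h u = h u' then (1 : ℝ) else 0) =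
      Fintype.card ({j // j ≠ u} → B) := by
    rw [← (Equiv.funSplitAt u B).symm.sum_comp, Fintype.sum_prod_type_right]
    simp [huu.symm]
  rw [h1, Fintype.card_congr (Equiv.funSplitAt u B), Fintype.card_prod]
  push_cast
  exact le_rfl

theorem IsUniversal.comp_snd [Fintype I] [Fintype J] [Fintype B] {h : I → α → B}
    (hh : IsUniversal h) : IsUniversal (fun i : J × I => h i.2) := by
  classical
  intro u u' huu
  have h1 : ∑ i : J × I, (if h i.2 u = h i.2 u' then (1 : ℝ) else 0) =
      ∑ _j : J, ∑ i, if h i u = h i u' then (1 : ℝ) else 0 := Fintype.sum_prod_type _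
  rw [h1, Finset.sum_const, Finset.card_univ, nsmul_eq_mul, Fintype.card_prod, Nat.cast_mul]
  have := mul_le_mul_of_nonneg_left (hh u u' huu) (Nat.cast_nonneg (α := ℝ) (Fintype.card J))
  linarith

theorem IsUniversal.prodMk [Fintype I] [Fintype J] [Fintype B] [Fintype B'] {h : I → α → B}
    {h' : J → α → B'} (hh : IsUniversal h) (hh' : IsUniversal h') :
    IsUniversal (fun (i : I × J) u => (h i.1 u, h' i.2 u)) := by
  classical
  intro u u' huu
  have h1 : ∑ i : I × J, (if (h i.1 u, h' i.2 u) = (h i.1 u', h' i.2 u') then (1 : ℝ) else 0) =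
      (∑ i, if h i u = h i u' then (1 : ℝ) else 0) *
        ∑ j, if h' j u = h' j u' then (1 : ℝ) else 0 := by
    rw [Fintype.sum_prod_type, Finset.sum_mul_sum]
    refine Finset.sum_congr rfl fun i _ => Finset.sum_congr rfl fun j _ => ?_
    by_cases h1 : h i u = h i u' <;> by_cases h2 : h' j u = h' j u' <;> simp [h1, h2]
  refine le_of_eq_of_le (congrArg _ (Eq.trans (Finset.sum_congr rfl fun i _ => ?_) h1)) ?_
  · congr
  rw [Fintype.card_prod, Fintype.card_prod]
  push_cast
  have := mul_le_mul (hh u u' huu) (hh' u u' huu)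
    (mul_nonneg (Nat.cast_nonneg _) (Finset.sum_nonneg fun _ _ => by positivity))
    (Nat.cast_nonneg _)
  linarith

theorem condPr_comp_eq_sum [Fintype Ω] [Fintype α] [DecidableEq B] (μ : PMF Ω) (X : Ω → α)
    (Y : Ω → β) (f : α → B) (c : B) (b : β) :
    condPr μ (fun ω => f (X ω)) Y c b = ∑ a, if f a = c then condPr μ X Y a b else 0 := by
  rw [condPr, pr_pair_comp_eq_sum, Finset.sum_div]
  refine Finset.sum_congr rfl fun a _ => ?_
  split_ifs <;> simp [condPr]

/-- The leftover hash lemma in terms of Shannon entropy: on average over a universal family, the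
gap between `log₂ |B|` and the conditional entropy of the hash `h i (U)` given `V` is at most
`E log₂ (1 + |B| p(U | V))`. By concavity of the logarithm it suffices to average the
conditional probability of the hash value inside the logarithm. -/
theorem sum_hash_deficit_le [Fintype Ω] [Fintype α] [Fintype β] [Fintype B] [Nonempty B]
    [Fintype I] (μ : PMF Ω) (U : Ω → α) (V : Ω → β) {h : I → α → B} (hh : IsUniversal h) :
    ∑ i, (Real.logb 2 (Fintype.card B) - condEntropy μ (fun ω => h i (U ω)) V) ≤
      Fintype.card I * ev μ (fun ω =>
        Real.logb 2 (1 + Fintype.card B * condPr μ U V (U ω) (V ω))) := by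
  classical
  have hB : (0 : ℝ) < Fintype.card B := by exact_mod_cast Fintype.card_pos
  have hterm : ∀ i, Real.logb 2 (Fintype.card B) - condEntropy μ (fun ω => h i (U ω)) V =
      ev μ (fun ω => Real.logb 2
        (Fintype.card B * condPr μ (fun ω => h i (U ω)) V (h i (U ω)) (V ω))) := by
    intro i
    rw [condEntropy_eq_ev, ← ev_const μ (Real.logb 2 (Fintype.card B)), ← ev_sub]
    refine ev_congr fun ω hω => ?_
    have := condPr_pos (fun ω => h i (U ω)) V hω
    rw [Real.logb_mul hB.ne' this.ne']
    ring
  simp only [hterm]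
  rw [← ev_sum, ← ev_const_mul]
  refine ev_le_ev fun ω hω => ?_
  set s : ℝ := 1 + Fintype.card B * condPr μ U V (U ω) (V ω) with hs
  have hs0 : 0 < s := by
    have := condPr_pos U V hω
    positivity
  have hlog2 := Real.log_pos one_lt_two
  have hmean : ∑ i, (Fintype.card B *
      condPr μ (fun ω => h i (U ω)) V (h i (U ω)) (V ω)) ≤ Fintype.card I * s := by
    calc ∑ i, ((Fintype.card B : ℝ) * condPr μ (fun ω => h i (U ω)) V (h i (U ω)) (V ω))
        = ∑ u, condPr μ U V u (V ω) *
            (Fintype.card B * ∑ i, if h i u = h i (U ω) then (1 : ℝ) else 0) := by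
          simp only [condPr_comp_eq_sum, Finset.mul_sum]
          rw [Finset.sum_comm]
          refine Finset.sum_congr rfl fun u _ => Finset.sum_congr rfl fun i _ => ?_
          split_ifs <;> ring
      _ ≤ ∑ u, condPr μ U V u (V ω) *
            (Fintype.card I + if u = U ω then (Fintype.card B * Fintype.card I : ℝ) else 0) := by
          refine Finset.sum_le_sum fun u _ =>
            mul_le_mul_of_nonneg_left ?_ (condPr_nonneg _ _ _ _)
          by_cases hu : u = U ω
          · simp [hu]
          · simpa [hu] using hh u (U ω) hu
      _ = (∑ u, condPr μ U V u (V ω)) * Fintype.card I +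
            Fintype.card I * (Fintype.card B * condPr μ U V (U ω) (V ω)) := by
          simp only [mul_add, Finset.sum_add_distrib, Finset.sum_mul]
          simp
          ring
      _ ≤ 1 * Fintype.card I + Fintype.card I * (Fintype.card B * condPr μ U V (U ω) (V ω)) := by
          gcongr
          exact sum_condPr_le_one U V (V ω)
      _ = Fintype.card I * s := by rw [hs]; ring
  calc ∑ i, Real.logb 2 (Fintype.card B *
        condPr μ (fun ω => h i (U ω)) V (h i (U ω)) (V ω))
      ≤ ∑ i, (Real.logb 2 s + (Fintype.card B *
        condPr μ (fun ω => h i (U ω)) V (h i (U ω)) (V ω) / s - 1) / Real.log 2) :=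
        Finset.sum_le_sum fun i _ =>
          logb_two_le (mul_pos hB (condPr_pos (fun ω => h i (U ω)) V hω)) hs0
    _ = Fintype.card I * Real.logb 2 s + ((∑ i, (Fintype.card B *
        condPr μ (fun ω => h i (U ω)) V (h i (U ω)) (V ω))) / s - Fintype.card I) /
          Real.log 2 := by
        rw [Finset.sum_add_distrib, ← Finset.sum_div, Finset.sum_sub_distrib, ← Finset.sum_div]
        simp
    _ ≤ Fintype.card I * Real.logb 2 s + 0 := by
        gcongr
        refine div_nonpos_of_nonpos_of_nonneg ?_ hlog2.le
        rw [sub_nonpos, div_le_iff₀ hs0]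
        exact hmean
    _ = _ := add_zero _

theorem hash_deficit_nonneg [Fintype Ω] [Fintype β] [Fintype B] [Nonempty B] (μ : PMF Ω)
    (X : Ω → B) (V : Ω → β) : 0 ≤ Real.logb 2 (Fintype.card B) - condEntropy μ X V :=
  sub_nonneg.2 (condEntropy_le_logb_card X V)

/-- For blocks of i.i.d. samples, the bound of the leftover hash lemma is `O(√L)` once
`log₂ M` does not exceed the conditional entropy of the block by more than a constant. -/
theorem ev_iid_logb_one_add_le {Θ : Type*} [Fintype Θ] [Fintype α] [Fintype β] (P : PMF Θ)
    (f : Θ → α) (g : Θ → β) {L : ℕ} (hL : 1 ≤ L) {M : ℝ} (hM : 0 < M) :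
    ev (iid P L) (fun z => Real.logb 2 (1 + M * condPr (iid P L) (fun z l => f (z l))
        (fun z l => g (z l)) (fun l => f (z l)) (fun l => g (z l)))) ≤
      1 + max 0 (Real.logb 2 M - L * condEntropy P f g) + √L * (infoVar P f g + 1) := by
  have hL0 : (0 : ℝ) < L := by exact_mod_cast hL
  set d : (Fin L → Θ) → ℝ := fun z => -Real.logb 2 (condPr (iid P L) (fun z l => f (z l))
        (fun z l => g (z l)) (fun l => f (z l)) (fun l => g (z l))) -
        L * condEntropy P f g with hd
  have hsq : √(L : ℝ) * √L = L := Real.mul_self_sqrt hL0.le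
  have hs0 : 0 < √(L : ℝ) := Real.sqrt_pos.2 hL0
  calc _ ≤ ev (iid P L) (fun z => 1 + max 0 (Real.logb 2 M - L * condEntropy P f g) +
        ((√L)⁻¹ * d z ^ 2 + √L)) := by
        refine ev_le_ev fun z hz => ?_
        have hp := condPr_pos (fun (z : Fin L → Θ) l => f (z l)) (fun z l => g (z l)) hz
        set p := condPr (iid P L) (fun z l => f (z l))
          (fun z l => g (z l)) (fun l => f (z l)) (fun l => g (z l)) with hpdef
        have h1 : Real.logb 2 (1 + M * p) ≤ 1 + max 0 (Real.logb 2 (M * p)) := by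
          have hMp := mul_pos hM hp
          have hle : 1 + M * p ≤ 2 * max 1 (M * p) := by
            rcases le_total 1 (M * p) with h | h
            · rw [max_eq_right h]; linarith
            · rw [max_eq_left h]; linarith
          refine (Real.logb_le_logb_of_le one_lt_two (by positivity) hle).trans ?_
          rw [Real.logb_mul two_ne_zero (by positivity), Real.logb_self_eq_one one_lt_two]
          rcases le_total 1 (M * p) with h | h
          · rw [max_eq_right h]
            exact add_le_add_right (le_max_right _ _) 1
          · rw [max_eq_left h, Real.logb_one]
            exact add_le_add_right (le_max_left _ _) 1
        have h2 : max 0 (Real.logb 2 (M * p)) ≤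
            max 0 (Real.logb 2 M - L * condEntropy P f g) + |d z| := by
          have hdz : d z = -Real.logb 2 p - L * condEntropy P f g := rfl
          rw [Real.logb_mul hM.ne' hp.ne']
          refine max_le (by positivity) ?_
          have := le_max_right 0 (Real.logb 2 M - L * condEntropy P f g)
          have := neg_abs_le (d z)
          linarith
        have h3 : |d z| ≤ (√L)⁻¹ * d z ^ 2 + √L := by
          have e : (√(L : ℝ))⁻¹ * d z ^ 2 + √L = (√L)⁻¹ * (d z ^ 2 + √L * √L) := by
            field_simp
          rw [e, inv_mul_eq_div, le_div_iff₀ hs0, ← sq_abs]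
          nlinarith [sq_nonneg (|d z| - √L), abs_nonneg (d z)]
        linarith
    _ = _ := by
        rw [ev_add, ev_const, ev_add, ev_const, ev_const_mul, ev_iid_info_sq]
        have : (√(L : ℝ))⁻¹ * (L * infoVar P f g) = √L * infoVar P f g := by
          field_simp
          rw [sq, hsq]
        rw [this]
        ring

/-- A universal hash of a block has conditional entropy within `O(√L)` of its number of bits, on
average over the family, if that number exceeds the conditional entropy of the block by at most a
constant. -/
theorem sum_hash_deficit_iid_le {Θ : Type*} [Fintype Θ] [Fintype α] [Fintype β] [Fintype B]
    [Nonempty B] [Fintype I] (P : PMF Θ) (f : Θ → α) (g : Θ → β) {L : ℕ} (hL : 1 ≤ L)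
    {h : I → (Fin L → α) → B} (hh : IsUniversal h)
    (hB : Real.logb 2 (Fintype.card B) ≤ L * condEntropy P f g + 2) :
    ∑ i, (Real.logb 2 (Fintype.card B) -
        condEntropy (iid P L) (fun z => h i (fun l => f (z l))) (fun z l => g (z l))) ≤
      Fintype.card I * ((infoVar P f g + 3) * (1 + √(L : ℝ))) := by
  have hB0 : (0 : ℝ) < Fintype.card B := by exact_mod_cast Fintype.card_pos
  refine (sum_hash_deficit_le (iid P L) (fun z l => f (z l)) (fun z l => g (z l)) hh).trans
    (mul_le_mul_of_nonneg_left ((ev_iid_logb_one_add_le P f g hL hB0).trans ?_)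
      (Nat.cast_nonneg _))
  have h1 : max 0 (Real.logb 2 (Fintype.card B) - L * condEntropy P f g) ≤ 2 :=
    max_le (by norm_num) (by linarith)
  have h2 := infoVar_nonneg P f g
  have h3 := Real.sqrt_nonneg (L : ℝ)
  linarith

/-- One hash function works against several pieces of side information at once. -/
theorem exists_hash {Θ ι : Type*} [Fintype Θ] [Fintype α] [Fintype B] [Nonempty B] (P : PMF Θ)
    (f : Θ → α) (E : Finset ι) {β : ι → Type*} [∀ e, Fintype (β e)] (g : ∀ e, Θ → β e) {L : ℕ}
    (hL : 1 ≤ L)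
    (hB : ∀ e ∈ E, Real.logb 2 (Fintype.card B) ≤ L * condEntropy P f (g e) + 2) :
    ∃ h : (Fin L → α) → B, ∀ e ∈ E, Real.logb 2 (Fintype.card B) -
        condEntropy (iid P L) (fun z => h (fun l => f (z l))) (fun z l => g e (z l)) ≤
      (∑ e ∈ E, (infoVar P f (g e) + 3)) * (1 + √(L : ℝ)) := by
  classical
  have hsum : ∑ h : (Fin L → α) → B, ∑ e ∈ E, (Real.logb 2 (Fintype.card B) -
        condEntropy (iid P L) (fun z => h (fun l => f (z l))) (fun z l => g e (z l))) ≤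
      ∑ _h : (Fin L → α) → B, (∑ e ∈ E, (infoVar P f (g e) + 3)) * (1 + √(L : ℝ)) := by
    rw [Finset.sum_comm, Finset.sum_const, Finset.card_univ, nsmul_eq_mul, Finset.sum_mul,
      Finset.mul_sum]
    exact Finset.sum_le_sum fun e he =>
      sum_hash_deficit_iid_le P f (g e) hL isUniversal_id (hB e he)
  obtain ⟨h, -, hh⟩ := Finset.exists_le_of_sum_le Finset.univ_nonempty hsum
  refine ⟨h, fun e he => le_trans ?_ hh⟩
  exact Finset.single_le_sum (f := fun e => Real.logb 2 (Fintype.card B) -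
    condEntropy (iid P L) (fun z => h (fun l => f (z l))) (fun z l => g e (z l)))
    (fun e _ => hash_deficit_nonneg _ _ _) he

/-! ### Slepian–Wolf decoding -/

open Classical in
/-- The decoder which recovers `u` from its hash `g u = b` and the side information `v`: it
looks for a `u` with that hash which is likely given `v`, that is, whose conditional probability
exceeds the threshold `τ`. -/
noncomputable def thresholdDecode [Nonempty α] (g : α → B) (p : α → β → ℝ) (τ : ℝ) (b : B)
    (v : β) : α :=
  if h : ∃ u, g u = b ∧ τ < p u v then h.choose else Classical.arbitrary α

open Classical in
/-- Decoding goes wrong only if `u` itself is unlikely or a likely `u'` has the same hash; the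
indicator of `τ < p u' v` is at most `p u' v / τ`. -/
theorem thresholdDecode_error_le [Fintype α] [Nonempty α] (g : α → B) (p : α → β → ℝ)
    (hp : ∀ u v, 0 ≤ p u v) {τ : ℝ} (hτ : 0 < τ) (u : α) (v : β) :
    (if thresholdDecode g p τ (g u) v ≠ u then (1 : ℝ) else 0) ≤
      (if p u v ≤ τ then 1 else 0) +
        ∑ u', (if u' ≠ u then (if g u' = g u then (1 : ℝ) else 0) * (p u' v / τ) else 0) := by
  have hnn : ∀ u', 0 ≤
      (if u' ≠ u then (if g u' = g u then (1 : ℝ) else 0) * (p u' v / τ) else 0) := by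
    intro u'
    have := div_nonneg (hp u' v) hτ.le
    split_ifs <;> simp [this]
  by_cases hu : p u v ≤ τ
  · rw [if_pos hu]
    have := Finset.sum_nonneg fun u' (_ : u' ∈ Finset.univ) => hnn u'
    split_ifs <;> linarith
  by_cases hdec : thresholdDecode g p τ (g u) v = u
  · rw [if_neg (not_not.2 hdec), if_neg hu, zero_add]
    exact Finset.sum_nonneg fun u' _ => hnn u'
  have hex : ∃ u', g u' = g u ∧ τ < p u' v := ⟨u, rfl, not_le.1 hu⟩
  have hspec : g (thresholdDecode g p τ (g u) v) = g u ∧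
      τ < p (thresholdDecode g p τ (g u) v) v := by
    rw [thresholdDecode, dif_pos hex]
    exact hex.choose_spec
  set u' := thresholdDecode g p τ (g u) v
  rw [if_pos hdec, if_neg hu, zero_add]
  refine le_trans ?_ (Finset.single_le_sum (fun u' _ => hnn u') (Finset.mem_univ u'))
  rw [if_pos hdec, if_pos hspec.1, one_mul, one_le_div hτ]
  exact hspec.2.le

theorem sum_thresholdDecode_error_le [Fintype Ω] [Fintype α] [Nonempty α] [Fintype B]
    [Nonempty B] [Fintype I] (μ : PMF Ω) (U : Ω → α) (V : Ω → β) {g : I → α → B}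
    (hg : IsUniversal g) {τ : ℝ} (hτ : 0 < τ) :
    ∑ i, prob μ (fun ω => thresholdDecode (g i) (condPr μ U V) τ (g i (U ω)) (V ω) ≠ U ω) ≤
      Fintype.card I * (prob μ (fun ω => condPr μ U V (U ω) (V ω) ≤ τ) +
        1 / (Fintype.card B * τ)) := by
  classical
  simp only [prob_eq_ev]
  have hB : (0 : ℝ) < Fintype.card B := by exact_mod_cast Fintype.card_pos
  rw [← ev_sum, ← ev_const μ (1 / (Fintype.card B * τ)), ← ev_add, ← ev_const_mul]
  refine ev_le_ev fun ω _ => ?_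
  calc ∑ i, (if thresholdDecode (g i) (condPr μ U V) τ (g i (U ω)) (V ω) ≠ U ω then (1 : ℝ)
          else 0)
      ≤ ∑ i, ((if condPr μ U V (U ω) (V ω) ≤ τ then (1 : ℝ) else 0) +
        ∑ u', (if u' ≠ U ω then
          (if g i u' = g i (U ω) then (1 : ℝ) else 0) * (condPr μ U V u' (V ω) / τ) else 0)) :=
        Finset.sum_le_sum fun i _ =>
          thresholdDecode_error_le (g i) _ (condPr_nonneg U V) hτ (U ω) (V ω)
    _ = Fintype.card I * (if condPr μ U V (U ω) (V ω) ≤ τ then (1 : ℝ) else 0) +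
        ∑ u', (if u' ≠ U ω then (∑ i, if g i u' = g i (U ω) then (1 : ℝ) else 0) *
          (condPr μ U V u' (V ω) / τ) else 0) := by
        rw [Finset.sum_add_distrib, Finset.sum_const, Finset.card_univ, nsmul_eq_mul,
          Finset.sum_comm]
        congr 1
        refine Finset.sum_congr rfl fun u' _ => ?_
        split_ifs
        · rw [Finset.sum_mul]
        · simp
    _ ≤ Fintype.card I * (if condPr μ U V (U ω) (V ω) ≤ τ then (1 : ℝ) else 0) +
        ∑ u', (Fintype.card I / Fintype.card B) * (condPr μ U V u' (V ω) / τ) := by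
        refine add_le_add_right (Finset.sum_le_sum fun u' _ => ?_) _
        have h0 := div_nonneg (condPr_nonneg (μ := μ) U V u' (V ω)) hτ.le
        split_ifs with h
        · refine mul_le_mul_of_nonneg_right ?_ h0
          rw [le_div_iff₀ hB, mul_comm]
          exact hg u' (U ω) h
        · positivity
    _ = Fintype.card I * ((if condPr μ U V (U ω) (V ω) ≤ τ then (1 : ℝ) else 0) +
        (∑ u', condPr μ U V u' (V ω)) / (Fintype.card B * τ)) := by
        rw [← Finset.mul_sum, ← Finset.sum_div]
        field_simp
    _ ≤ _ := by
        gcongr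
        exact sum_condPr_le_one U V (V ω)

/-- Chebyshev's inequality for the information density of a block. -/
theorem ev_iid_condPr_le {Θ : Type*} [Fintype Θ] [Fintype α] [Fintype β] (P : PMF Θ)
    (f : Θ → α) (g : Θ → β) {L : ℕ} (hL : 1 ≤ L) {ε : ℝ} (hε : 0 < ε) :
    prob (iid P L) (fun z => condPr (iid P L) (fun z l => f (z l)) (fun z l => g (z l))
        (fun l => f (z l)) (fun l => g (z l)) ≤ 2 ^ (-(L * (condEntropy P f g + ε)))) ≤
      infoVar P f g / ε ^ 2 / L := by
  classical
  rw [prob_eq_ev]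
  have hL0 : (0 : ℝ) < L := by exact_mod_cast hL
  calc _ ≤ ev (iid P L) (fun z => (L * ε)⁻¹ ^ 2 * (-Real.logb 2 (condPr (iid P L)
          (fun z l => f (z l)) (fun z l => g (z l)) (fun l => f (z l)) (fun l => g (z l))) -
          L * condEntropy P f g) ^ 2) := by
        refine ev_le_ev fun z hz => ?_
        have hp := condPr_pos (fun (z : Fin L → Θ) l => f (z l)) (fun z l => g (z l)) hz
        beta_reduce at hp
        generalize condPr (iid P L) (fun z l => f (z l)) (fun z l => g (z l))
          (fun l => f (z l)) (fun l => g (z l)) = p at hp ⊢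
        split_ifs with hle
        · have h1 := Real.logb_le_logb_of_le one_lt_two hp hle
          rw [Real.logb_rpow two_pos (by norm_num)] at h1
          rw [← mul_pow, inv_mul_eq_div]
          refine one_le_pow₀ ?_
          rw [one_le_div (by positivity)]
          linarith
        · positivity
    _ = _ := by
        rw [ev_const_mul, ev_iid_info_sq]
        field_simp

theorem le_two_rpow {x : ℝ} (hx : 0 ≤ x) : x ≤ 2 ^ x := by
  rcases le_total 1 x with h | h
  · have := one_add_mul_self_le_rpow_one_add (s := 1) (by norm_num) h
    norm_num at this
    linarith
  · exact h.trans (Real.one_le_rpow one_le_two hx)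

/-- Slepian–Wolf coding of a block: if the hash has at least `L (H(f | g) + 2ε)` bits, then `f`
is recovered from its hash and `g` with error probability `O(1 / L)`, on average over a
universal family. -/
theorem exists_threshold_sum_error_le {Θ : Type*} [Fintype Θ] [Fintype α] [Fintype β]
    [Nonempty α] [Fintype B] [Nonempty B] [Fintype I] (P : PMF Θ) (f : Θ → α) (g : Θ → β)
    {L : ℕ} (hL : 1 ≤ L) {ε : ℝ} (hε : 0 < ε) {h : I → (Fin L → α) → B} (hh : IsUniversal h)
    (hB : L * (condEntropy P f g + 2 * ε) ≤ Real.logb 2 (Fintype.card B)) :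
    ∃ τ, ∑ i, prob (iid P L) (fun z =>
        thresholdDecode (h i) (condPr (iid P L) (fun z l => f (z l)) (fun z l => g (z l))) τ
          (h i (fun l => f (z l))) (fun l => g (z l)) ≠ (fun l => f (z l))) ≤
      Fintype.card I * ((infoVar P f g / ε ^ 2 + 1 / ε) / L) := by
  have hL0 : (0 : ℝ) < L := by exact_mod_cast hL
  have hB0 : (0 : ℝ) < Fintype.card B := by exact_mod_cast Fintype.card_pos
  have hcheb := ev_iid_condPr_le P f g hL hε
  generalize condEntropy P f g = H at hB hcheb
  have hτ0 : (0 : ℝ) < 2 ^ (-(L * (H + ε))) := by positivity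
  refine ⟨2 ^ (-(L * (H + ε))), (sum_thresholdDecode_error_le (iid P L)
    (fun z l => f (z l)) (fun z l => g (z l)) hh hτ0).trans ?_⟩
  have h1 : (2 : ℝ) ^ (L * (H + 2 * ε)) ≤ Fintype.card B := by
    rw [← Real.le_logb_iff_rpow_le one_lt_two hB0]
    exact hB
  have h3 : (2 : ℝ) ^ (L * ε) ≤ Fintype.card B * 2 ^ (-(L * (H + ε))) := by
    calc (2 : ℝ) ^ (L * ε) = 2 ^ (L * (H + 2 * ε)) * 2 ^ (-(L * (H + ε))) := by
          rw [← Real.rpow_add two_pos]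
          ring_nf
      _ ≤ _ := mul_le_mul_of_nonneg_right h1 hτ0.le
  have h4 : 1 / (Fintype.card B * (2 : ℝ) ^ (-(L * (H + ε)))) ≤ 1 / ε / L := by
    rw [div_div, mul_comm ε]
    exact one_div_le_one_div_of_le (by positivity) ((le_two_rpow (by positivity)).trans h3)
  rw [add_div]
  exact mul_le_mul_of_nonneg_left (add_le_add hcheb h4) (Nat.cast_nonneg _)

/-- A universal family of pairs of hash functions has a member `(f, g)` such that `g` suffices to
recover a block from each of several pieces of side information, while `(f, g)` is nearly uniform
given `v`. -/
theorem IsUniversal.exists_pair {Θ ι β₀ : Type*} [Fintype Θ] [Fintype β₀] [Fintype B] [Nonempty B]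
    [Fintype B'] [Nonempty B'] [Fintype I] [Nonempty I] (P : PMF Θ) (v : Θ → β₀) (Q : Finset ι)
    {β : ι → Type*}
    [∀ q, Fintype (β q)] (s : ∀ q, Θ → β q) {L : ℕ} (hL : 1 ≤ L) [Nonempty Θ] {ε : ℝ}
    (hε : 0 < ε) {f : I → (Fin L → Θ) → B} {g : I → (Fin L → Θ) → B'}
    (hfg : IsUniversal fun i u => (f i u, g i u)) (hg : IsUniversal g)
    (hB : Real.logb 2 (Fintype.card (B × B')) ≤ L * condEntropy P (fun a => a) v + 2)
    (hB' : ∀ q ∈ Q,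
      L * (condEntropy P (fun a => a) (s q) + 2 * ε) ≤ Real.logb 2 (Fintype.card B')) :
    ∃ (i : I) (τ : ι → ℝ),
      Real.logb 2 (Fintype.card (B × B')) -
          condEntropy (iid P L) (fun z => (f i z, g i z)) (fun z l => v (z l)) ≤
        2 * (infoVar P (fun a => a) v + 3) * (1 + √(L : ℝ)) ∧
      ∀ q ∈ Q, prob (iid P L) (fun z =>
          thresholdDecode (g i) (condPr (iid P L) (fun z => z) (fun z l => s q (z l))) (τ q)
            (g i z) (fun l => s q (z l)) ≠ z) ≤
        2 * (1 + ∑ q ∈ Q, (infoVar P (fun a => a) (s q) / ε ^ 2 + 1 / ε)) / L := by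
  classical
  have hL0 : (0 : ℝ) < L := by exact_mod_cast hL
  have hτ : ∀ q, ∃ τ, q ∈ Q → ∑ i : I, prob (iid P L) (fun z =>
          thresholdDecode (g i) (condPr (iid P L) (fun z => z) (fun z l => s q (z l))) τ
            (g i z) (fun l => s q (z l)) ≠ z) ≤
      Fintype.card I * ((infoVar P (fun a => a) (s q) / ε ^ 2 + 1 / ε) / L) := by
    intro q
    by_cases hq : q ∈ Q
    · obtain ⟨τ, h⟩ := exists_threshold_sum_error_le P (fun a => a) (s q) hL hε hg (hB' q hq)
      exact ⟨τ, fun _ => h⟩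
    · exact ⟨0, fun h => absurd h hq⟩
  choose τ hτ using hτ
  set err : I → ι → ℝ := fun i q => prob (iid P L) (fun z =>
          thresholdDecode (g i) (condPr (iid P L) (fun z => z) (fun z l => s q (z l))) (τ q)
            (g i z) (fun l => s q (z l)) ≠ z) with herr
  set c : ι → ℝ := fun q => infoVar P (fun a => a) (s q) / ε ^ 2 + 1 / ε with hc
  have hc0 : ∀ q, 0 ≤ c q := fun q => by
    have := infoVar_nonneg P (fun a => a) (s q)
    simp only [hc]
    positivity
  set C := (1 + ∑ q ∈ Q, c q) / L with hC
  have hC0 : 0 < C := div_pos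
    (add_pos_of_pos_of_nonneg one_pos (Finset.sum_nonneg fun q _ => hc0 q)) hL0
  set D := (infoVar P (fun a => a) v + 3) * (1 + √(L : ℝ)) with hD
  have hD0 : 0 < D := by
    have := infoVar_nonneg P (fun a => a) v
    positivity
  set dft : I → ℝ := fun i => Real.logb 2 (Fintype.card (B × B')) -
    condEntropy (iid P L) (fun z => (f i z, g i z)) (fun z l => v (z l)) with hdft
  have hdft0 : ∀ i, 0 ≤ dft i := fun i => hash_deficit_nonneg _ _ _
  have herr0 : ∀ i, 0 ≤ ∑ q ∈ Q, err i q := fun i => Finset.sum_nonneg fun q _ => prob_nonneg _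
  have hdft_sum : ∑ i, dft i ≤ Fintype.card I * D := by
    have := sum_hash_deficit_iid_le P (fun a => a) v hL hfg hB
    exact this
  have herr_sum : ∑ i, ∑ q ∈ Q, err i q ≤ Fintype.card I * C := by
    rw [Finset.sum_comm]
    refine (Finset.sum_le_sum fun q hq => hτ q hq).trans ?_
    rw [← Finset.mul_sum, ← Finset.sum_div]
    refine mul_le_mul_of_nonneg_left ?_ (Nat.cast_nonneg _)
    exact div_le_div_of_nonneg_right (by linarith) hL0.le
  -- the two averages are normalised and added, so that one pair is good for both
  have hsum : ∑ i : I, (dft i / D + (∑ q ∈ Q, err i q) / C) ≤ ∑ _i : I, (2 : ℝ) := by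
    rw [Finset.sum_add_distrib, ← Finset.sum_div, ← Finset.sum_div, Finset.sum_const,
      Finset.card_univ, nsmul_eq_mul]
    have h1 := (div_le_iff₀ hD0).2 hdft_sum
    have h2 := (div_le_iff₀ hC0).2 herr_sum
    linarith
  obtain ⟨i, -, hi⟩ := Finset.exists_le_of_sum_le Finset.univ_nonempty hsum
  have h1 : dft i / D ≤ 2 := by
    have := div_nonneg (herr0 i) hC0.le
    linarith
  have h2 : (∑ q ∈ Q, err i q) / C ≤ 2 := by
    have := div_nonneg (hdft0 i) hD0.le
    linarith
  rw [div_le_iff₀ hD0] at h1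
  rw [div_le_iff₀ hC0] at h2
  refine ⟨i, τ, ?_, fun q hq => ?_⟩
  · rw [mul_assoc]
    exact h1
  · rw [mul_div_assoc]
    exact (Finset.single_le_sum (f := err i) (fun q _ => prob_nonneg _) hq).trans h2

/-- Two hash functions `f` and `g` of a block such that `g` suffices to recover the block from
each of several pieces of side information, while `(f, g)` is nearly uniform given `v`. -/
theorem exists_hash_pair {Θ ι β₀ : Type*} [Fintype Θ] [Fintype β₀] [Fintype B] [Nonempty B]
    [Fintype B'] [Nonempty B'] (P : PMF Θ) (v : Θ → β₀) (Q : Finset ι) {β : ι → Type*}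
    [∀ q, Fintype (β q)] (s : ∀ q, Θ → β q) {L : ℕ} (hL : 1 ≤ L) [Nonempty Θ] {ε : ℝ}
    (hε : 0 < ε)
    (hB : Real.logb 2 (Fintype.card (B × B')) ≤ L * condEntropy P (fun a => a) v + 2)
    (hB' : ∀ q ∈ Q,
      L * (condEntropy P (fun a => a) (s q) + 2 * ε) ≤ Real.logb 2 (Fintype.card B')) :
    ∃ (f : (Fin L → Θ) → B) (g : (Fin L → Θ) → B') (τ : ι → ℝ),
      Real.logb 2 (Fintype.card (B × B')) -
          condEntropy (iid P L) (fun z => (f z, g z)) (fun z l => v (z l)) ≤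
        2 * (infoVar P (fun a => a) v + 3) * (1 + √(L : ℝ)) ∧
      ∀ q ∈ Q, prob (iid P L) (fun z =>
          thresholdDecode g (condPr (iid P L) (fun z => z) (fun z l => s q (z l))) (τ q)
            (g z) (fun l => s q (z l)) ≠ z) ≤
        2 * (1 + ∑ q ∈ Q, (infoVar P (fun a => a) (s q) / ε ^ 2 + 1 / ε)) / L := by
  classical
  obtain ⟨i, τ, h⟩ := IsUniversal.exists_pair P v Q s hL hε
    (isUniversal_id.prodMk isUniversal_id)
    (isUniversal_id.comp_snd (J := (Fin L → Θ) → B)) hB hB'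
  exact ⟨i.1, i.2, τ, h⟩

end

/-! ### Entropies of a scheme -/

section

variable {K : ℕ} {𝒵 : Fin K → Type*} {L : ℕ}

namespace Scheme

variable (S : Scheme 𝒵 L)

theorem logb_card_msg :
    Real.logb 2 (Fintype.card S.Msg) = S.LW * Real.logb 2 (Fintype.card S.F) := by
  simp [Real.logb_pow]

theorem logb_card_sig :
    Real.logb 2 (Fintype.card S.Sig) = S.LX * Real.logb 2 (Fintype.card S.F) := by
  simp [Real.logb_pow]

theorem rate_mul (hL : 1 ≤ L) : S.rate * L = S.LW * Real.logb 2 (Fintype.card S.F) := by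
  have hL0 : (0 : ℝ) < L := by exact_mod_cast hL
  rw [rate, div_mul_cancel₀ _ hL0.ne']

theorem bandwidth_mul (hL : 1 ≤ L) :
    S.bandwidth * L = S.LX * Real.logb 2 (Fintype.card S.F) := by
  have hL0 : (0 : ℝ) < L := by exact_mod_cast hL
  rw [bandwidth, div_mul_cancel₀ _ hL0.ne']

variable [∀ k, Fintype (𝒵 k)] (P : PMF (∀ k, 𝒵 k))

theorem law_map_msg_keys :
    (S.law P).map (fun ω => (ω.1, ω.2.1)) =
      indepPair (PMF.uniformOfFintype S.Msg) (iid P L) := by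
  have h : ∀ w z, ((S.enc w z).map fun x => (w, z, x)).map
      (fun ω : S.Outcome => (ω.1, ω.2.1)) = PMF.pure (w, z) := by
    intro w z
    rw [PMF.map_comp]
    exact (S.enc w z).map_const (w, z)
  simp only [law, indepPair, PMF.map_bind, h]

theorem entropy_law {α : Type*} [Fintype α] (T : S.Msg × (Fin L → ∀ k, 𝒵 k) → α) :
    entropy (S.law P) (fun ω => T (ω.1, ω.2.1)) =
      entropy (indepPair (PMF.uniformOfFintype S.Msg) (iid P L)) T := by
  rw [← law_map_msg_keys, entropy_map]

theorem entropy_law_keys {α : Type*} [Fintype α] (T : (Fin L → ∀ k, 𝒵 k) → α) :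
    entropy (S.law P) (fun ω => T ω.2.1) = entropy (iid P L) T := by
  rw [S.entropy_law P (fun x => T x.2), ← entropy_map Prod.snd T, indepPair_map_snd]

theorem condEntropy_law_keys {α β : Type*} [Fintype α] [Fintype β]
    (T : (Fin L → ∀ k, 𝒵 k) → α) (T' : (Fin L → ∀ k, 𝒵 k) → β) :
    condEntropy (S.law P) (fun ω => T ω.2.1) (fun ω => T' ω.2.1) =
      condEntropy (iid P L) T T' := by
  rw [condEntropy, condEntropy, S.entropy_law_keys P T',
    S.entropy_law_keys P (fun z => (T z, T' z))]

theorem entropy_msg :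
    entropy (S.law P) S.W = S.LW * Real.logb 2 (Fintype.card S.F) := by
  rw [← logb_card_msg, ← entropy_uniform, ← indepPair_map_fst (PMF.uniformOfFintype S.Msg)
    (iid P L), entropy_map]
  exact S.entropy_law P Prod.fst

theorem entropy_msg_keys {α : Type*} [Fintype α] (T : (Fin L → ∀ k, 𝒵 k) → α) :
    entropy (S.law P) (fun ω => (S.W ω, T ω.2.1)) =
      S.LW * Real.logb 2 (Fintype.card S.F) + entropy (iid P L) T := by
  rw [← logb_card_msg, ← entropy_uniform, ← entropy_indepPair]
  exact S.entropy_law P (fun x => (x.1, T x.2))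

theorem equivocation_nonneg (k : Fin K) : 0 ≤ S.equivocation P k := condEntropy_nonneg _ _

theorem leakage_eq (k : Fin K) :
    S.leakage P k = S.LW * Real.logb 2 (Fintype.card S.F) -
      condEntropy (S.law P) S.W (fun ω => (S.X ω, S.Z k ω)) := by
  rw [leakage, mutualInfo, entropy_msg, condEntropy]
  ring

theorem leakage_nonneg (k : Fin K) : 0 ≤ S.leakage P k := by
  rw [leakage_eq, sub_nonneg, ← logb_card_msg]
  exact condEntropy_le_logb_card _ _

theorem leakage_le (k : Fin K) :
    S.leakage P k ≤ S.LW * Real.logb 2 (Fintype.card S.F) := by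
  rw [leakage_eq]
  exact sub_le_self _ (condEntropy_nonneg _ _)

theorem condEntropy_key (k e : Fin K) :
    condEntropy (S.law P) (S.Z k) (S.Z e) = L * keyCondEntropy P k e :=
  (S.condEntropy_law_keys P (fun z l => z l k) (fun z l => z l e)).trans
    (condEntropy_iid P (fun z => z k) (fun z => z e))

theorem errorProb_eq (k : Fin K) :
    S.errorProb P k = prob (S.law P) (fun ω => S.dec k (S.X ω) (S.Z k ω) ≠ S.W ω) := by
  classical
  rw [errorProb, PMF.toOuterMeasure_apply_fintype, prob_eq_ev, ENNReal.toReal_sum]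
  · refine Finset.sum_congr rfl fun ω _ => ?_
    by_cases h : S.dec k (S.X ω) (S.Z k ω) = S.W ω <;> simp [Set.indicator, h]
  · intro ω _
    rw [Set.indicator_apply]
    split_ifs
    · exact PMF.apply_ne_top _ _
    · simp

theorem errorProb_nonneg (k : Fin K) : 0 ≤ S.errorProb P k := ENNReal.toReal_nonneg

theorem equivocation_le (k : Fin K) :
    S.equivocation P k ≤
      1 + S.errorProb P k * (S.LW * Real.logb 2 (Fintype.card S.F)) := by
  rw [errorProb_eq, ← logb_card_msg]
  exact condEntropy_le_fano S.W (fun ω => (S.X ω, S.Z k ω)) (fun y => S.dec k y.1 y.2)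

/-! ### Converse -/

/-- A message hidden from Receiver `e` and known to Receiver `k` is covered by the randomness
which the key of `k` retains given the key of `e`. -/
theorem message_bits_le (k e : Fin K) :
    S.LW * Real.logb 2 (Fintype.card S.F) ≤
      S.leakage P e + S.equivocation P k + L * keyCondEntropy P k e := by
  have h1 := entropy_comp_le (μ := S.law P)
    (fun ω => (S.W ω, ((S.X ω, S.Z k ω), S.Z e ω))) (fun y => (y.1, (y.2.1.1, y.2.2)))
  have h2 := condEntropy_le_condEntropy_comp (μ := S.law P) S.W
    (fun ω => ((S.X ω, S.Z k ω), S.Z e ω)) Prod.fst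
  have h3 := entropy_comp_le (μ := S.law P)
    (fun ω => (S.Z k ω, (S.X ω, S.Z e ω))) (fun y => ((y.2.1, y.1), y.2.2))
  have h4 := condEntropy_le_condEntropy_comp (μ := S.law P) (S.Z k)
    (fun ω => (S.X ω, S.Z e ω)) Prod.snd
  rw [← S.condEntropy_key P k e]
  rw [leakage_eq, equivocation]
  simp only [condEntropy] at h1 h2 h3 h4 ⊢
  linarith

/-- A receiver that knows the message must have learnt it from the transmit signal, since its
key is independent of the message. -/
theorem message_bits_le_signal_bits (k : Fin K) :
    S.LW * Real.logb 2 (Fintype.card S.F) ≤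
      S.equivocation P k + S.LX * Real.logb 2 (Fintype.card S.F) := by
  have h1 := entropy_comp_le (μ := S.law P)
    (fun ω => (S.W ω, (S.X ω, S.Z k ω))) (fun y => (y.1, y.2.2))
  have h2 := condEntropy_le_logb_card (μ := S.law P) S.X (S.Z k)
  have h3 : entropy (S.law P) (fun ω => (S.W ω, S.Z k ω)) = _ :=
    S.entropy_msg_keys P (fun z l => z l k)
  have h4 : entropy (S.law P) (S.Z k) = _ := S.entropy_law_keys P (fun z l => z l k)
  rw [logb_card_sig] at h2
  rw [equivocation]
  simp only [condEntropy] at h1 h2 ⊢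
  linarith

end Scheme

variable [∀ k, Fintype (𝒵 k)]

theorem le_of_isLittleO {f : ℕ → ℝ} (hf : f =o[atTop] (fun L : ℕ => (L : ℝ))) {R H : ℝ}
    (h : ∀ L : ℕ, 1 ≤ L → R * L ≤ f L + H * L) : R ≤ H := by
  refine le_of_forall_pos_le_add fun ε hε => ?_
  obtain ⟨L, hL, hL1⟩ := ((hf.bound hε).and (eventually_ge_atTop 1)).exists
  have hL0 : (0 : ℝ) < L := by exact_mod_cast hL1
  have h1 := h L hL1
  have h2 := (le_abs_self (f L)).trans hL
  rw [Real.norm_of_nonneg hL0.le] at h2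
  refine le_of_mul_le_mul_right ?_ hL0
  linarith

theorem AchievableRate.le_keyCondEntropy {conv : Convention} {P : PMF (∀ k, 𝒵 k)} {N : ℕ}
    {R : ℝ} (h : AchievableRate conv P N R) {k e : Fin K} (hk : k ∈ legitimate K N)
    (he : e ∈ eavesdroppers K N) : R ≤ keyCondEntropy P k e := by
  obtain ⟨S, ⟨-, -, hcor, hsec⟩, hR⟩ := h
  refine le_of_isLittleO ((hsec e he).add (hcor k hk)) fun L hL => ?_
  have h1 := (S L).message_bits_le P k e
  have h2 := mul_le_mul_of_nonneg_right (hR L hL) (Nat.cast_nonneg (α := ℝ) L)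
  rw [(S L).rate_mul hL] at h2
  linarith

theorem AchievableBandwidth.rate_le {conv : Convention} {P : PMF (∀ k, 𝒵 k)} {N : ℕ}
    {R b : ℝ} (h : AchievableBandwidth conv P N R b) {k : Fin K} (hk : k ∈ legitimate K N) :
    R ≤ b := by
  obtain ⟨S, ⟨-, -, hcor, -⟩, hR⟩ := h
  refine le_of_isLittleO (hcor k hk) fun L hL => ?_
  have h1 := (S L).message_bits_le_signal_bits P k
  have h2 := mul_le_mul_of_nonneg_right (hR L hL).1 (Nat.cast_nonneg (α := ℝ) L)
  have h3 := mul_le_mul_of_nonneg_right (hR L hL).2 (Nat.cast_nonneg (α := ℝ) L)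
  rw [(S L).rate_mul hL] at h2
  rw [(S L).bandwidth_mul hL] at h3
  linarith

/-! ### Sufficient conditions for achievability -/

theorem isLittleO_of_le_sqrt {f : ℕ → ℝ} (h0 : ∀ L, 0 ≤ f L) {a : ℝ}
    (h : ∀ᶠ L : ℕ in atTop, f L ≤ a * (1 + √(L : ℝ))) :
    f =o[atTop] (fun L : ℕ => (L : ℝ)) := by
  have hO : f =O[atTop] (fun L : ℕ => 1 + √(L : ℝ)) := by
    refine IsBigO.of_bound a (h.mono fun L hL => ?_)
    rwa [Real.norm_of_nonneg (h0 L), Real.norm_of_nonneg (by positivity)]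
  refine hO.trans_isLittleO (IsLittleO.add ?_ ?_)
  · exact isLittleO_const_left.2 (Or.inr (tendsto_norm_atTop_atTop.comp
      tendsto_natCast_atTop_atTop))
  · refine (isLittleO_iff_tendsto' ?_).2 ?_
    · filter_upwards [eventually_ge_atTop 1] with L hL h0
      exact absurd (Nat.cast_eq_zero.1 h0) (by omega)
    · simp only [Real.sqrt_div_self]
      exact (tendsto_inv_atTop_zero.comp
        (Real.tendsto_sqrt_atTop.comp tendsto_natCast_atTop_atTop)).congr fun L => by simp

/-- Deterministic schemes with error probability `O(1 / L)`, leakage `O(√L)` and bounded rate are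
admissible under every convention; by Fano's inequality the equivocation is then bounded. -/
theorem isCorrectSecure_of_bounds (conv : Convention) (P : PMF (∀ k, 𝒵 k)) (N : ℕ)
    (S : ∀ L, Scheme 𝒵 L) (hdet : ∀ L, (S L).IsDeterministic) {a b c : ℝ}
    (hrate : ∀ᶠ L in atTop, (S L).rate ≤ a)
    (herr : ∀ k ∈ legitimate K N, ∀ᶠ L : ℕ in atTop, (S L).errorProb P k ≤ b / L)
    (hleak : ∀ k ∈ eavesdroppers K N,
      ∀ᶠ L : ℕ in atTop, (S L).leakage P k ≤ c * (1 + √(L : ℝ))) :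
    IsCorrectSecure conv P N S := by
  refine ⟨fun _ => hdet, fun _ k hk => ?_, fun k hk => ?_, fun k hk => ?_⟩
  · exact squeeze_zero' (.of_forall fun L => (S L).errorProb_nonneg P k) (herr k hk)
      (tendsto_const_div_atTop_nhds_zero_nat b)
  · refine isLittleO_of_le_sqrt (a := 1 + |b| * |a|)
      (fun L => (S L).equivocation_nonneg P k) ?_
    filter_upwards [herr k hk, hrate, eventually_ge_atTop 1] with L h1 h2 hL
    have hL0 : (0 : ℝ) < L := by exact_mod_cast hL
    have h3 := (S L).equivocation_le P k
    rw [← (S L).rate_mul hL] at h3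
    have h4 : (S L).errorProb P k * ((S L).rate * L) ≤ (|b| / L) * (|a| * L) := by
      have h5 : (S L).rate * L ≤ |a| * L :=
        mul_le_mul_of_nonneg_right (h2.trans (le_abs_self a)) hL0.le
      have h6 : (S L).errorProb P k ≤ |b| / L :=
        h1.trans (div_le_div_of_nonneg_right (le_abs_self b) hL0.le)
      have h7 := (S L).errorProb_nonneg P k
      calc _ ≤ (S L).errorProb P k * (|a| * L) := mul_le_mul_of_nonneg_left h5 h7
        _ ≤ _ := mul_le_mul_of_nonneg_right h6 (by positivity)
    have h8 : (|b| / L) * (|a| * L) = |b| * |a| := by field_simp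
    have h9 : 0 ≤ (1 + |b| * |a|) * √(L : ℝ) := by positivity
    linarith
  · exact isLittleO_of_le_sqrt (fun L => (S L).leakage_nonneg P k) (hleak k hk)

end

/-! ### Deterministic schemes -/

section

variable {K : ℕ} {𝒵 : Fin K → Type*} {L : ℕ}

namespace Scheme

section Deterministic

variable {S : Scheme 𝒵 L} {e : S.Msg → (Fin L → ∀ k, 𝒵 k) → S.Sig} [∀ k, Fintype (𝒵 k)]

theorem law_eq_map (hS : ∀ w z, S.enc w z = PMF.pure (e w z)) (P : PMF (∀ k, 𝒵 k)) :
    S.law P = (indepPair (PMF.uniformOfFintype S.Msg) (iid P L)).map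
      (fun x => (x.1, x.2, e x.1 x.2)) := by
  simp only [law, hS, indepPair, PMF.map_bind, PMF.pure_map]

theorem errorProb_le_prob (hS : ∀ w z, S.enc w z = PMF.pure (e w z)) (P : PMF (∀ k, 𝒵 k))
    {k : Fin K} (bad : (Fin L → ∀ k, 𝒵 k) → Prop)
    (h : ∀ w z, ¬ bad z → S.dec k (e w z) (fun l => z l k) = w) :
    S.errorProb P k ≤ prob (iid P L) bad := by
  rw [errorProb_eq, law_eq_map hS, prob_map]
  nth_rw 2 [← indepPair_map_snd (PMF.uniformOfFintype S.Msg) (iid P L)]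
  rw [prob_map]
  exact prob_mono fun x hx => not_not.1 fun hb => hx (h x.1 x.2 hb)

/-- If, given the key of Receiver `k`, the signal carries no more than a value `Y` in `B` and, once
the message is known, reveals a function `h` of the keys, then the leakage to `k` is at most the
gap between `log₂ |B|` and the conditional entropy of `h`. -/
theorem leakage_le_hash_deficit (hS : ∀ w z, S.enc w z = PMF.pure (e w z)) (P : PMF (∀ k, 𝒵 k))
    {B : Type*} [Fintype B] [Nonempty B] {k : Fin K}
    (h : (Fin L → ∀ k, 𝒵 k) → B) (Y : S.Msg → (Fin L → ∀ k, 𝒵 k) → B)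
    (φ : B → (Fin L → 𝒵 k) → S.Sig) (hφ : ∀ w z, e w z = φ (Y w z) (fun l => z l k))
    (ψ : S.Msg → S.Sig → (Fin L → 𝒵 k) → B) (hψ : ∀ w z, ψ w (e w z) (fun l => z l k) = h z) :
    S.leakage P k ≤
      Real.logb 2 (Fintype.card B) - condEntropy (iid P L) h (fun z l => z l k) := by
  set ν := indepPair (PMF.uniformOfFintype S.Msg) (iid P L) with hν
  set key : (Fin L → ∀ k, 𝒵 k) → Fin L → 𝒵 k := fun z l => z l k with hkey
  have hXZ : entropy (S.law P) (fun ω => (S.X ω, S.Z k ω)) =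
      entropy ν (fun x => (e x.1 x.2, key x.2)) := by
    rw [law_eq_map hS, entropy_map]
    rfl
  have hWXZ : entropy (S.law P) (fun ω => (S.W ω, (S.X ω, S.Z k ω))) =
      entropy ν (fun x => (x.1, (e x.1 x.2, key x.2))) := by
    rw [law_eq_map hS, entropy_map]
    rfl
  have h1 : entropy ν (fun x => (e x.1 x.2, key x.2)) ≤
      entropy ν (fun x => (Y x.1 x.2, key x.2)) := by
    simp only [hφ]
    exact entropy_comp_le (μ := ν) (fun x => (Y x.1 x.2, key x.2)) (fun y => (φ y.1 y.2, y.2))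
  have h2 := condEntropy_le_logb_card (μ := ν) (fun x => Y x.1 x.2) (fun x => key x.2)
  have h3 : entropy ν (fun x => key x.2) = entropy (iid P L) key := by
    rw [← entropy_map Prod.snd key, indepPair_map_snd]
  have h4 : entropy ν (fun x => (x.1, (h x.2, key x.2))) ≤
      entropy ν (fun x => (x.1, (e x.1 x.2, key x.2))) := by
    have hψ' : ∀ w z, h z = ψ w (e w z) (key z) := fun w z => (hψ w z).symm
    rw [show (fun x : S.Msg × (Fin L → ∀ k, 𝒵 k) => (x.1, (h x.2, key x.2))) =
      fun x => (x.1, (ψ x.1 (e x.1 x.2) (key x.2), key x.2)) from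
      funext fun x => by rw [← hψ' x.1 x.2]]
    exact entropy_comp_le (μ := ν) (fun x => (x.1, (e x.1 x.2, key x.2)))
      (fun y => (y.1, (ψ y.1 y.2.1 y.2.2, y.2.2)))
  have h5 := entropy_indepPair (PMF.uniformOfFintype S.Msg) (iid P L)
    (fun w => w) (fun z => (h z, key z))
  have h6 : entropy (S.law P) S.W = entropy (PMF.uniformOfFintype S.Msg) (fun w => w) := by
    rw [entropy_msg, entropy_uniform, logb_card_msg]
  rw [leakage, mutualInfo, hXZ, hWXZ, h6]
  rw [← hν] at h5
  simp only [condEntropy] at h2 ⊢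
  linarith

end Deterministic

/-- The scheme over `𝔽₂` with encoding function `e` and decoding functions `d`. -/
noncomputable def ofFun (LW LX : ℕ)
    (e : (Fin LW → ZMod 2) → (Fin L → ∀ k, 𝒵 k) → Fin LX → ZMod 2)
    (d : ∀ k, (Fin LX → ZMod 2) → (Fin L → 𝒵 k) → Fin LW → ZMod 2) : Scheme 𝒵 L where
  F := ZMod 2
  LW := LW
  LX := LX
  enc w z := PMF.pure (e w z)
  dec := d

variable {LW LX : ℕ} (e : (Fin LW → ZMod 2) → (Fin L → ∀ k, 𝒵 k) → Fin LX → ZMod 2)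
  (d : ∀ k, (Fin LX → ZMod 2) → (Fin L → 𝒵 k) → Fin LW → ZMod 2)

theorem isDeterministic_ofFun : (ofFun LW LX e d).IsDeterministic := fun w z => ⟨e w z, rfl⟩

theorem logb_card_ofFun : Real.logb 2 (Fintype.card (ofFun LW LX e d).F) = 1 := by
  have h : Fintype.card (ofFun LW LX e d).F = 2 := ZMod.card 2
  rw [h]
  exact Real.logb_self_eq_one one_lt_two

theorem rate_ofFun : (ofFun LW LX e d).rate = LW / L := by
  rw [rate, logb_card_ofFun, mul_one]
  rfl

theorem bandwidth_ofFun : (ofFun LW LX e d).bandwidth = LX / L := by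
  rw [bandwidth, logb_card_ofFun, mul_one]
  rfl

end Scheme

theorem logb_card_bits (m : ℕ) : Real.logb 2 (Fintype.card (Fin m → ZMod 2)) = m := by
  simp [ZMod.card, Real.logb_pow]

/-- A scheme which sends nothing. It has the given rate, but is of use only for an empty message or
where no correctness is asked for. -/
theorem exists_silent_scheme (𝒵 : Fin K → Type*) [∀ k, Fintype (𝒵 k)] (L m : ℕ) :
    ∃ S : Scheme 𝒵 L, S.IsDeterministic ∧ S.rate = m / L ∧ S.bandwidth = 0 ∧
      (m = 0 → ∀ P k, S.errorProb P k = 0 ∧ S.leakage P k = 0) := by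
  refine ⟨Scheme.ofFun m 0 (fun _ _ => 0) (fun _ _ _ => 0),
    Scheme.isDeterministic_ofFun _ _, Scheme.rate_ofFun _ _, ?_, ?_⟩
  · rw [Scheme.bandwidth_ofFun]
    simp
  · rintro rfl P k
    constructor
    · refine le_antisymm ?_ (Scheme.errorProb_nonneg _ _ _)
      refine (Scheme.errorProb_le_prob (e := fun _ _ => 0) (fun _ _ => rfl) P (fun _ => False)
        fun w z _ => Subsingleton.elim (α := Fin 0 → ZMod 2) _ _).trans ?_
      simp [prob, ev]
    · refine le_antisymm ((Scheme.leakage_le _ P k).trans_eq ?_) (Scheme.leakage_nonneg _ P k)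
      rw [Scheme.logb_card_ofFun]
      exact (mul_one _).trans Nat.cast_zero

variable [∀ k, Fintype (𝒵 k)]

/-- Unicast: the message is encrypted by a one-time pad, which is a hash of the key of the
legitimate receiver. -/
theorem exists_unicast_scheme (P : PMF (∀ k, 𝒵 k)) (k : Fin K) (E : Finset (Fin K)) {L : ℕ}
    (hL : 1 ≤ L) (m : ℕ) (hm : ∀ e ∈ E, (m : ℝ) ≤ L * keyCondEntropy P k e + 2) :
    ∃ S : Scheme 𝒵 L, S.IsDeterministic ∧ S.rate = m / L ∧ S.bandwidth = m / L ∧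
      S.errorProb P k = 0 ∧
      ∀ e ∈ E, S.leakage P e ≤
        (∑ e ∈ E, (infoVar P (fun z => z k) (fun z => z e) + 3)) * (1 + √(L : ℝ)) := by
  obtain ⟨f, hf⟩ := exists_hash (B := Fin m → ZMod 2) P (fun z => z k) E
    (fun e (z : ∀ k, 𝒵 k) => z e) hL (by rw [logb_card_bits]; exact hm)
  let f' : ∀ k', (Fin L → 𝒵 k') → Fin m → ZMod 2 := Function.update (fun _ _ => 0) k f
  have hf' : f' k = f := Function.update_self _ _ _
  let enc : (Fin m → ZMod 2) → (Fin L → ∀ k, 𝒵 k) → Fin m → ZMod 2 :=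
    fun w z => w + f (fun l => z l k)
  have hdec : ∀ w z, enc w z - f' k (fun l => z l k) = w := fun w z => by
    rw [hf']
    exact add_sub_cancel_right _ _
  let unpad : (Fin m → ZMod 2) → (Fin m → ZMod 2) → Fin m → ZMod 2 := fun w x => x - w
  refine ⟨Scheme.ofFun m m enc (fun k' x y => x - f' k' y),
    Scheme.isDeterministic_ofFun _ _, Scheme.rate_ofFun _ _, Scheme.bandwidth_ofFun _ _, ?_,
    fun e he => le_trans ?_ (hf e he)⟩
  · refine le_antisymm ?_ (Scheme.errorProb_nonneg _ _ _)
    refine (Scheme.errorProb_le_prob (e := enc) (fun _ _ => rfl) P (fun _ => False)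
      fun w z _ => hdec w z).trans ?_
    simp [prob, ev]
  · exact Scheme.leakage_le_hash_deficit (e := enc) (fun _ _ => rfl) P
      (fun z => f (fun l => z l k)) enc (fun x _ => x) (fun _ _ => rfl) (fun w x _ => unpad w x)
      (fun w z => add_sub_cancel_left (G := Fin m → ZMod 2) w (f fun l => z l k))

/-- Multicast against Receiver `r`: the transmitter reveals the key block of `r`, and a hash which
lets the legitimate receivers recover all keys from it; another hash of all keys serves as a
one-time pad. -/
theorem exists_multicast_scheme (P : PMF (∀ k, 𝒵 k)) (r : Fin K) (Q : Finset (Fin K)) {ε : ℝ}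
    (hε : 0 < ε) {L : ℕ} (hL : 1 ≤ L) (m n : ℕ)
    (hmn : (m + n : ℝ) ≤ L * condEntropy P (fun z => z) (fun z => z r) + 2)
    (hn : ∀ q ∈ Q, L * (condEntropy P (fun z => z) (fun z => (z q, z r)) + 2 * ε) ≤ n) :
    ∃ S : Scheme 𝒵 L, S.IsDeterministic ∧ S.rate = m / L ∧
      (∀ q ∈ Q, S.errorProb P q ≤
        2 * (1 + ∑ q ∈ Q, (infoVar P (fun z => z) (fun z => (z q, z r)) / ε ^ 2 + 1 / ε)) / L) ∧
      S.leakage P r ≤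
        2 * (infoVar P (fun z => z) (fun z => z r) + 3) * (1 + √(L : ℝ)) := by
  have hne : Nonempty (∀ k, 𝒵 k) := P.support_nonempty.to_type
  have hcard : Real.logb 2 (Fintype.card ((Fin m → ZMod 2) × (Fin n → ZMod 2))) = m + n := by
    rw [Fintype.card_prod, Nat.cast_mul, Real.logb_mul (by positivity) (by positivity),
      logb_card_bits, logb_card_bits]
  obtain ⟨f, g, τ, hdft, herr⟩ := exists_hash_pair (B := Fin m → ZMod 2) (B' := Fin n → ZMod 2) P
    (fun z => z r) Q (fun q (z : ∀ k, 𝒵 k) => (z q, z r)) hL hε (by rw [hcard]; exact hmn)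
    (by rw [logb_card_bits]; exact hn)
  -- the bandwidth plays no role here, so any injection into a set of bit strings will do
  let T := (Fin L → 𝒵 r) × ((Fin m → ZMod 2) × (Fin n → ZMod 2))
  obtain ⟨j⟩ : Nonempty (T ↪ (Fin (Fintype.card T) → ZMod 2)) := by
    refine Function.Embedding.nonempty_of_card_le ?_
    simpa [ZMod.card] using (Nat.lt_two_pow_self (n := Fintype.card T)).le
  have : Nonempty T := ⟨(fun _ => hne.some r, 0, 0)⟩
  have hj : ∀ t, Function.invFun j (j t) = t := Function.leftInverse_invFun j.injective
  let enc : (Fin m → ZMod 2) → (Fin L → ∀ k, 𝒵 k) → Fin (Fintype.card T) → ZMod 2 :=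
    fun w z => j (fun l => z l r, w + f z, g z)
  let dec : ∀ k, (Fin (Fintype.card T) → ZMod 2) → (Fin L → 𝒵 k) → Fin m → ZMod 2 :=
    fun k x y => (Function.invFun j x).2.1 -
      f (thresholdDecode g (condPr (iid P L) (fun z => z) (fun z l => (z l k, z l r))) (τ k)
        (Function.invFun j x).2.2 (fun l => (y l, (Function.invFun j x).1 l)))
  let pad : (Fin m → ZMod 2) → (Fin L → ∀ k, 𝒵 k) → (Fin m → ZMod 2) × (Fin n → ZMod 2) :=
    fun w z => (w + f z, g z)
  let unpad : (Fin m → ZMod 2) → (Fin (Fintype.card T) → ZMod 2) →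
      (Fin m → ZMod 2) × (Fin n → ZMod 2) :=
    fun w x => ((Function.invFun j x).2.1 - w, (Function.invFun j x).2.2)
  have hunpad : ∀ w z, unpad w (enc w z) = (f z, g z) := fun w z => by
    simp only [unpad, enc, hj, add_sub_cancel_left]
  have hdec : ∀ q w z,
      thresholdDecode g (condPr (iid P L) (fun z => z) (fun z l => (z l q, z l r))) (τ q)
        (g z) (fun l => (z l q, z l r)) = z → dec q (enc w z) (fun l => z l q) = w :=
    fun q w z hz => by
      simp only [dec, enc, hj]
      rw [hz, add_sub_cancel_right]
  refine ⟨Scheme.ofFun m _ enc dec, Scheme.isDeterministic_ofFun _ _, Scheme.rate_ofFun _ _,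
    fun q hq => le_trans ?_ (herr q hq), le_trans ?_ hdft⟩
  · refine Scheme.errorProb_le_prob (e := enc) (fun _ _ => rfl) P _ fun w z hz => ?_
    exact hdec q w z (not_not.1 hz)
  · exact Scheme.leakage_le_hash_deficit (e := enc) (fun _ _ => rfl) P (fun z => (f z, g z))
      pad (fun b y => j (y, b)) (fun _ _ => rfl) (fun w x _ => unpad w x) hunpad

theorem keyCondEntropy_nonneg (P : PMF (∀ k, 𝒵 k)) (i j : Fin K) : 0 ≤ keyCondEntropy P i j :=
  condEntropy_nonneg _ _

/-- The chain rule `H(z | z_q, z_r) = H(z | z_r) - H(z_q | z_r)`. -/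
theorem condEntropy_all_pair (P : PMF (∀ k, 𝒵 k)) (q r : Fin K) :
    condEntropy P (fun z => z) (fun z => (z q, z r)) =
      condEntropy P (fun z => z) (fun z => z r) - keyCondEntropy P q r := by
  have h : entropy P (fun z => (z, (z q, z r))) = entropy P (fun z => (z, z r)) :=
    le_antisymm (entropy_comp_le (μ := P) (fun z => (z, z r))
      (fun y : (∀ k, 𝒵 k) × 𝒵 r => (y.1, (y.1 q, y.2))))
      (entropy_comp_le (μ := P) (fun z => (z, (z q, z r))) (fun y => (y.1, y.2.2)))
  simp only [keyCondEntropy, condEntropy, h]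
  ring

end

/-! ### Achievability -/

section

variable {K : ℕ} {𝒵 : Fin K → Type*} [∀ k, Fintype (𝒵 k)]

theorem le_natCeil_div {L : ℕ} (hL : 1 ≤ L) (R : ℝ) : R ≤ (⌈L * R⌉₊ : ℝ) / L := by
  have hL0 : (0 : ℝ) < L := by exact_mod_cast hL
  rw [le_div_iff₀ hL0, mul_comm]
  exact Nat.le_ceil _

theorem eventually_natCeil_div_le {R b : ℝ} (hR : 0 ≤ R) (hb : R < b) :
    ∀ᶠ L : ℕ in atTop, (⌈L * R⌉₊ : ℝ) / L ≤ b := by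
  filter_upwards [eventually_ge_atTop 1,
    tendsto_natCast_atTop_atTop.eventually_ge_atTop (1 / (b - R))] with L hL h
  have hL0 : (0 : ℝ) < L := by exact_mod_cast hL
  rw [div_le_iff₀ (sub_pos.2 hb)] at h
  rw [div_le_iff₀ hL0]
  have := Nat.ceil_lt_add_one (mul_nonneg hL0.le hR)
  linarith

/-- The rate `C` itself is achieved, at any bandwidth above `C`. -/
theorem achievableBandwidth_unicast (conv : Convention) (P : PMF (∀ k, 𝒵 k)) {k₀ : Fin K}
    (hk : ∀ k ∈ legitimate K 1, k = k₀) {C b : ℝ} (hC0 : 0 ≤ C)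
    (hC : ∀ e ∈ eavesdroppers K 1, C ≤ keyCondEntropy P k₀ e) (hb : C < b) :
    AchievableBandwidth conv P 1 C b := by
  have hgood := fun (L : ℕ) (hL : 1 ≤ L) => exists_unicast_scheme P k₀ (eavesdroppers K 1) hL
    ⌈L * C⌉₊ fun e he => by
      have h1 := Nat.ceil_lt_add_one (mul_nonneg (Nat.cast_nonneg (α := ℝ) L) hC0)
      have h2 := mul_le_mul_of_nonneg_left (hC e he) (Nat.cast_nonneg (α := ℝ) L)
      linarith
  choose good hdet hrate hband herr hleak using hgood
  choose silent hdet' hrate' hband' _ using fun L : ℕ => exists_silent_scheme 𝒵 L ⌈L * C⌉₊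
  -- for short blocks rounding up `L C` may exceed `L b`; nothing is sent there, which is harmless
  -- because correctness is asymptotic
  let S : ∀ L, Scheme 𝒵 L := fun L =>
    if h : 1 ≤ L ∧ (⌈L * C⌉₊ : ℝ) / L ≤ b then good L h.1 else silent L
  have hS : ∀ (L : ℕ) (h : 1 ≤ L ∧ (⌈L * C⌉₊ : ℝ) / L ≤ b), S L = good L h.1 := fun L h => dif_pos h
  have hS' : ∀ L : ℕ, ¬(1 ≤ L ∧ (⌈L * C⌉₊ : ℝ) / L ≤ b) → S L = silent L := fun L h => dif_neg h
  have hrateS : ∀ L, (S L).rate = (⌈L * C⌉₊ : ℝ) / L := fun L => by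
    by_cases h : 1 ≤ L ∧ (⌈L * C⌉₊ : ℝ) / L ≤ b
    · rw [hS L h, hrate]
    · rw [hS' L h, hrate']
  have hev := (eventually_ge_atTop 1).and (eventually_natCeil_div_le hC0 hb)
  refine ⟨S, isCorrectSecure_of_bounds conv P 1 S (fun L => ?_) (a := b) (b := 0)
      (c := ∑ e ∈ eavesdroppers K 1, (infoVar P (fun z => z k₀) (fun z => z e) + 3)) ?_ ?_ ?_,
    fun L hL => ⟨?_, ?_⟩⟩
  · by_cases h : 1 ≤ L ∧ (⌈L * C⌉₊ : ℝ) / L ≤ b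
    · rw [hS L h]
      exact hdet _ _
    · rw [hS' L h]
      exact hdet' _
  · exact hev.mono fun L h => (hrateS L).trans_le h.2
  · intro k hk1
    filter_upwards [hev] with L h
    rw [hS L h, hk k hk1, herr, zero_div]
  · intro e he
    filter_upwards [hev] with L h
    rw [hS L h]
    exact hleak L h.1 e he
  · rw [hrateS]
    exact le_natCeil_div hL C
  · by_cases h : 1 ≤ L ∧ (⌈L * C⌉₊ : ℝ) / L ≤ b
    · rw [hS L h, hband]
      exact h.2
    · rw [hS' L h, hband']
      linarith

theorem achievableRate_of_nonpos (conv : Convention) (P : PMF (∀ k, 𝒵 k)) (N : ℕ) {R : ℝ}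
    (hR : R ≤ 0) : AchievableRate conv P N R := by
  choose S hdet hrate _ hzero using fun L : ℕ => exists_silent_scheme 𝒵 L 0
  refine ⟨S, isCorrectSecure_of_bounds conv P N S hdet (a := 0) (b := 0) (c := 0) ?_ ?_ ?_,
    fun L _ => ?_⟩
  · exact .of_forall fun L => by simp [hrate]
  · exact fun k _ => .of_forall fun L => by simp [hzero L rfl P k]
  · exact fun k _ => .of_forall fun L => by simp [hzero L rfl P k]
  · simpa [hrate] using hR

/-- Every rate below `min_q H(z_q | z_r)` is achieved when `r` is the only eavesdropper. -/
theorem achievableRate_multicast (conv : Convention) (P : PMF (∀ k, 𝒵 k)) {N : ℕ} {r : Fin K}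
    (hN : (legitimate K N).Nonempty) (hr : ∀ e ∈ eavesdroppers K N, e = r) {R C : ℝ}
    (hC : ∀ q ∈ legitimate K N, C ≤ keyCondEntropy P q r) (hR : R < C) :
    AchievableRate conv P N R := by
  rcases le_or_gt R 0 with hR0 | hR0
  · exact achievableRate_of_nonpos conv P N hR0
  -- the pad has rate `R` and the recovery hash `H - C + 2 ε`; together this is exactly `H`
  set ε := (C - R) / 2 with hε
  have hε0 : 0 < ε := half_pos (sub_pos.2 hR)
  set H := condEntropy P (fun z => z) (fun z => z r) with hH
  have hHq : ∀ q ∈ legitimate K N,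
      condEntropy P (fun z => z) (fun z => (z q, z r)) + 2 * ε ≤ H - C + 2 * ε := fun q hq => by
    rw [condEntropy_all_pair]
    have := hC q hq
    linarith
  have hn0 : 0 ≤ H - C + 2 * ε := by
    obtain ⟨q, hq⟩ := hN
    have h1 := hHq q hq
    have h2 := condEntropy_nonneg (μ := P) (fun z => z) (fun z => (z q, z r))
    linarith
  have hgood := fun (L : ℕ) (hL : 1 ≤ L) => exists_multicast_scheme P r (legitimate K N) hε0 hL
    ⌈L * R⌉₊ ⌈L * (H - C + 2 * ε)⌉₊ (by
      have h1 := Nat.ceil_lt_add_one (mul_nonneg (Nat.cast_nonneg (α := ℝ) L) hR0.le)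
      have h2 := Nat.ceil_lt_add_one (mul_nonneg (Nat.cast_nonneg (α := ℝ) L) hn0)
      have h3 : L * R + L * (H - C + 2 * ε) = L * H := by rw [hε]; ring
      linarith)
    fun q hq => (mul_le_mul_of_nonneg_left (hHq q hq) (Nat.cast_nonneg _)).trans (Nat.le_ceil _)
  choose good hdet hrate herr hleak using hgood
  choose silent hdet' _ _ _ using fun L : ℕ => exists_silent_scheme 𝒵 L 0
  let S : ∀ L, Scheme 𝒵 L := fun L => if h : 1 ≤ L then good L h else silent L
  have hS : ∀ L (h : 1 ≤ L), S L = good L h := fun L h => dif_pos h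
  have hS' : ∀ L, ¬(1 ≤ L) → S L = silent L := fun L h => dif_neg h
  refine ⟨S, isCorrectSecure_of_bounds conv P N S (fun L => ?_) (a := R + 1)
    (b := 2 * (1 + ∑ q ∈ legitimate K N,
      (infoVar P (fun z => z) (fun z => (z q, z r)) / ε ^ 2 + 1 / ε)))
    (c := 2 * (infoVar P (fun z => z) (fun z => z r) + 3)) ?_
    (fun q hq => ?_) (fun e he => ?_), fun L hL => ?_⟩
  · by_cases h : 1 ≤ L
    · rw [hS L h]
      exact hdet _ _
    · rw [hS' L h]
      exact hdet' _
  · filter_upwards [eventually_ge_atTop 1,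
      eventually_natCeil_div_le hR0.le (lt_add_one R)] with L hL h
    rw [hS L hL, hrate]
    exact h
  · filter_upwards [eventually_ge_atTop 1] with L hL
    rw [hS L hL]
    exact herr L hL q hq
  · filter_upwards [eventually_ge_atTop 1] with L hL
    rw [hS L hL, hr e he]
    exact hleak L hL
  · rw [hS L hL, hrate]
    exact le_natCeil_div hL R

theorem AchievableBandwidth.achievableRate {conv : Convention} {P : PMF (∀ k, 𝒵 k)} {N : ℕ}
    {R b : ℝ} (h : AchievableBandwidth conv P N R b) : AchievableRate conv P N R :=
  h.imp fun _ h => ⟨h.1, fun L hL => (h.2 L hL).1⟩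

end

end SecureGroupcast

theorem theorem9 {K : ℕ} (hK : 2 ≤ K) {𝒵 : Fin K → Type*} [∀ k, Fintype (𝒵 k)]
    (P : PMF (∀ k, 𝒵 k)) (conv : SecureGroupcast.Convention) :
    -- unicast to the first receiver: capacity and minimum bandwidth at capacity
    (∃ C : ℝ,
      C = (SecureGroupcast.eavesdroppers K 1).inf'
        (SecureGroupcast.eavesdroppers_nonempty (by omega))
        (fun e => SecureGroupcast.keyCondEntropy P ⟨0, by omega⟩ e) ∧
      SecureGroupcast.IsCapacity conv P 1 C ∧
      SecureGroupcast.IsMinBandwidth conv P 1 C C) ∧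
    -- multicast to the first `K - 1` receivers: capacity
    SecureGroupcast.IsCapacity conv P (K - 1)
      ((SecureGroupcast.legitimate K (K - 1)).inf'
        (SecureGroupcast.legitimate_nonempty (by omega) (by omega))
        (fun q => SecureGroupcast.keyCondEntropy P q ⟨K - 1, by omega⟩)) := by
  open SecureGroupcast in
  refine ⟨⟨_, rfl, ?_⟩, ?_⟩
  · have hk0 : (⟨0, by omega⟩ : Fin K) ∈ legitimate K 1 := by simp [legitimate]
    have hk : ∀ k ∈ legitimate K 1, k = ⟨0, by omega⟩ := fun k hk => by
      simp only [legitimate, Finset.mem_filter, Finset.mem_univ, true_and] at hk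
      exact Fin.ext (by simpa using hk)
    set C := (eavesdroppers K 1).inf' (eavesdroppers_nonempty (by omega))
      (fun e => keyCondEntropy P ⟨0, by omega⟩ e) with hCdef
    have hC0 : 0 ≤ C := Finset.le_inf' _ _ fun e _ => keyCondEntropy_nonneg P _ e
    have hC : ∀ e ∈ eavesdroppers K 1, C ≤ keyCondEntropy P ⟨0, by omega⟩ e :=
      fun e he => Finset.inf'_le _ he
    have hach : ∀ b, C < b → AchievableBandwidth conv P 1 C b := fun b hb =>
      achievableBandwidth_unicast conv P hk hC0 hC hb
    refine ⟨IsGreatest.isLUB ⟨(hach _ (lt_add_one C)).achievableRate, fun R hR => ?_⟩,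
      fun b hb => hb.rate_le hk0, fun b hb => ?_⟩
    · exact Finset.le_inf' _ _ fun e he => hR.le_keyCondEntropy hk0 he
    · exact le_of_forall_gt_imp_ge_of_dense fun b' hb' => hb (hach b' hb')
  · have hr : (⟨K - 1, by omega⟩ : Fin K) ∈ eavesdroppers K (K - 1) := by
      rw [eavesdroppers, Finset.mem_filter]
      exact ⟨Finset.mem_univ _, le_rfl⟩
    have hr' : ∀ e ∈ eavesdroppers K (K - 1), e = ⟨K - 1, by omega⟩ := fun e he => by
      simp only [eavesdroppers, Finset.mem_filter, Finset.mem_univ, true_and] at he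
      exact Fin.ext (by have := e.isLt; simp; omega)
    refine ⟨fun R hR => Finset.le_inf' _ _ fun q hq => hR.le_keyCondEntropy hq hr,
      fun b hb => le_of_forall_lt_imp_le_of_dense fun R hR => hb ?_⟩
    exact achievableRate_multicast conv P (legitimate_nonempty (by omega) (by omega)) hr'
      (fun q hq => Finset.inf'_le _ hq) hR
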